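/- **Lemma 8.9.** Let $d\ge 0$ be an integer, let $X=\mathbb R^d/\mathbb Z^d$ be the flat torus with distance $d(x,y)^2=\inf_{m\in\mathbb Z^d}|x-y-m|^2$ and normalized Lebesgue measure $dx$, and let $P(X)$ be the space of Borel probability measures on $X$ with the weak topology. Let $\mu_0\in P(X)$ have full support, i.e. $\mu_0(U)>0$ for every nonempty open $U\subset X$. For $n\ge 1$ let $p_1,\dots,p_{n^d}$ be the points of the lattice $\frac1n\mathbb Z^d$ modulo $\mathbb Z^d$, and put $$\phi^{(n)}_i(x)=\sum_{m\in\mathbb Z^d}e^{-n|x-p_i-m|^2},\qquad \Phi(x_1,\dots,x_{n^d})=\big[\phi^{(n)}_i(x_j)\big]_{i,j=1}^{n^d}.$$ Let $H_n:X^{n^d}\to\mathbb R$ be either $H_n=-\frac1n\log\operatorname{per}\Phi$, where $\operatorname{per}A=\sum_{\sigma}\prod_iA_{i\sigma(i)}$, or $H_n=-\frac1n\log\operatorname{tsper}\Phi$, where $\operatorname{tsper}A=\sup_{\sigma}\prod_iA_{i\sigma(i)}$, with $\sigma$ ranging over the permutations of $\{1,\dots,n^d\}$. Let $\delta^{n^d}(x_1,\dots,x_{n^d})=\frac1{n^d}\sum_{i}\delta_{x_i}\in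 P(X)$ and $$\Gamma_{n,n}=\frac1{Z_{n,n}}\,\delta^{n^d}_{\#}\big(e^{-nH_n}\mu_0^{\otimes n^d}\big)\in P(P(X)),\qquad Z_{n,n}=\int_{X^{n^d}}e^{-nH_n}\,d\mu_0^{\otimes n^d}.$$ Then, for both choices of $H_n$, the sequence $(\Gamma_{n,n})_{n\ge1}$ of probability measures satisfies a large deviation principle with speed $n^{d+1}$ and rate function $$I(\nu)=W_2^2(dx,\nu):=\inf_{\gamma\in\Pi(dx,\nu)}\int_{X\times X}d(x,y)^2\,d\gamma(x,y),$$ where $\Pi(dx,\nu)$ is the set of probability measures on $X\times X$ with marginals $dx$ and $\nu$. That is, $I$ is lower semicontinuous and, with $\log 0=-\infty$ and $\inf\emptyset=+\infty$, $$\liminf_{n\to\infty}\frac1{n^{d+1}}\log\Gamma_{n,n}(O)\ge-\inf_OI\ \text{ for all open }O\subset P(X),\qquad \limsup_{n\to\infty}\frac1{n^{d+1}}\log\Gamma_{n,n}(C)\le-\inf_CI\ \text{ for all closed }C\subset P(X).$$ -/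

import Mathlib

open MeasureTheory Filter Topology
open scoped ENNReal

noncomputable section

namespace TorusLDP

/-- The large deviation principle, with normalization (speed) `r` and rate function `I`, for a
sequence `μ` of probability measures on a topological space. Infima over the empty set are `∞`
and `log 0 = -∞`. -/
structure LDP {𝓧 : Type*} [TopologicalSpace 𝓧] [MeasurableSpace 𝓧]
    (μ : ℕ → Measure 𝓧) (r : ℕ → ℝ) (I : 𝓧 → ℝ≥0∞) : Prop where
  isProbabilityMeasure : ∀ n, IsProbabilityMeasure (μ n)
  speed_pos : ∀ n, 0 < r n
  speed_monotone : Monotone r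
  speed_tendsto : Tendsto r atTop atTop
  lowerSemicontinuous : LowerSemicontinuous I
  lower_bound : ∀ O : Set 𝓧, IsOpen O →
    -((⨅ x ∈ O, I x : ℝ≥0∞) : EReal) ≤
      liminf (fun n => ((1 / r n : ℝ) : EReal) * ENNReal.log (μ n O)) atTop
  upper_bound : ∀ C : Set 𝓧, IsClosed C →
    limsup (fun n => ((1 / r n : ℝ) : EReal) * ENNReal.log (μ n C)) atTop ≤
      -((⨅ x ∈ C, I x : ℝ≥0∞) : EReal)

section Torus

variable {d : ℕ}

/-- The integer vector `m ∈ ℤ^d` as a vector of Euclidean space. -/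
def intVec (m : Fin d → ℤ) : EuclideanSpace ℝ (Fin d) :=
  WithLp.toLp 2 (fun k => (m k : ℝ))

/-- The representative in `[0,1)^d` of a point of the torus `ℝ^d / ℤ^d`. -/
def rep (x : UnitAddTorus (Fin d)) : EuclideanSpace ℝ (Fin d) :=
  WithLp.toLp 2 (fun k => (AddCircle.equivIco (1 : ℝ) 0 (x k) : ℝ))

/-- `rep x` does represent `x`. -/
theorem coe_rep (x : UnitAddTorus (Fin d)) (k : Fin d) : ((rep x k : ℝ) : UnitAddCircle) = x k :=
  (AddCircle.equivIco (1 : ℝ) 0).symm_apply_apply (x k)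

/-- The squared flat distance of the torus, `d(x,y)² = inf_{m ∈ ℤ^d} |x - y - m|²`. -/
def sqDist (x y : UnitAddTorus (Fin d)) : ℝ :=
  ⨅ m : Fin d → ℤ, ‖rep x - rep y - intVec m‖ ^ 2

/-- The squared Wasserstein distance `W₂²(μ,ν)`: the infimum, over all transportation plans `γ`
from `μ` to `ν`, of the total cost `∫ d(x,y)² γ(dx,dy)`. -/
def W2sq (μ ν : Measure (UnitAddTorus (Fin d))) : ℝ≥0∞ :=
  ⨅ γ ∈ {γ : Measure (UnitAddTorus (Fin d) × UnitAddTorus (Fin d)) |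
      IsProbabilityMeasure γ ∧ γ.map Prod.fst = μ ∧ γ.map Prod.snd = ν},
    ∫⁻ z, ENNReal.ofReal (sqDist z.1 z.2) ∂γ

/-- The theta function `∑_{m ∈ ℤ^d} exp (-n |x - p - m|²)`, a `ℤ^d`-periodic function of `x`. -/
def theta (n : ℕ) (p x : EuclideanSpace ℝ (Fin d)) : ℝ :=
  ∑' m : Fin d → ℤ, Real.exp (-(n : ℝ) * ‖x - p - intVec m‖ ^ 2)

/-- By periodicity `theta n p` is a function on the torus: its value at `x` does not depend on the
representative of `x`. -/
theorem theta_add_intVec (n : ℕ) (p x : EuclideanSpace ℝ (Fin d)) (l : Fin d → ℤ) :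
    theta n p (x + intVec l) = theta n p x := by
  unfold theta
  rw [← (Equiv.addRight l).tsum_eq]
  refine tsum_congr fun m => ?_
  have h : x + intVec l - p - intVec (m + l) = x - p - intVec m := by
    ext k
    simp [intVec]
    ring
  simp only [Equiv.coe_addRight, h]

/-- The `n^d` points of the lattice `(1/n)ℤ^d` in the cube, one for each point modulo `ℤ^d`. -/
def gridPoint (n : ℕ) (i : Fin d → Fin n) : EuclideanSpace ℝ (Fin d) :=
  WithLp.toLp 2 (fun k => ((i k : ℕ) : ℝ) / n)

/-- The `n^d × n^d` matrix `Φ = [φ_i(x_j)]`; configurations of `n^d` points of the torus are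
indexed by the `n^d` elements of `Fin d → Fin n`. -/
def thetaMatrix (n : ℕ) (x : (Fin d → Fin n) → UnitAddTorus (Fin d)) :
    Matrix (Fin d → Fin n) (Fin d → Fin n) ℝ :=
  Matrix.of fun i j => theta n (gridPoint n i) (rep (x j))

/-- The semi-tropical permanent: the sum in the permanent is replaced by a supremum. -/
def tropicalPermanent {ι : Type*} [Fintype ι] (A : Matrix ι ι ℝ) : ℝ :=
  ⨆ σ : Equiv.Perm ι, ∏ i, A i (σ i)

/-- The permanental Hamiltonian `H_n = -(1/n) log per Φ`. -/
def hamiltonian (n : ℕ) (x : (Fin d → Fin n) → UnitAddTorus (Fin d)) : ℝ :=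
  -(1 / (n : ℝ)) * Real.log (thetaMatrix n x).permanent

/-- The semi-tropical Hamiltonian `H_n = -(1/n) log tsper Φ`. -/
def tropicalHamiltonian (n : ℕ) (x : (Fin d → Fin n) → UnitAddTorus (Fin d)) : ℝ :=
  -(1 / (n : ℝ)) * Real.log (tropicalPermanent (thetaMatrix n x))

end Torus

section Gibbs

variable {X ι : Type*} [MeasurableSpace X] [Fintype ι]

/-- The empirical measure `(1/N) ∑ δ_{x_i}` of a nonempty configuration of `N` points. -/
def empirical [Nonempty ι] (x : ι → X) : ProbabilityMeasure X :=
  ⟨(Fintype.card ι : ℝ≥0∞)⁻¹ • ∑ i, Measure.dirac (x i), ⟨by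
    simp [ENNReal.inv_mul_cancel (Nat.cast_ne_zero.mpr Fintype.card_ne_zero)
      (ENNReal.natCast_ne_top _)]⟩⟩

/-- The partition function `Z = ∫ exp (-β H) dμ₀^{⊗ N}`. -/
def partitionFunction (μ₀ : Measure X) (β : ℝ) (H : (ι → X) → ℝ) : ℝ≥0∞ :=
  ∫⁻ x, ENNReal.ofReal (Real.exp (-β * H x)) ∂(Measure.pi fun _ : ι => μ₀)

/-- The law of the empirical measure under the Gibbs measure `exp (-β H) μ₀^{⊗ N} / Z`. -/
def empiricalGibbsLaw [Nonempty ι] (μ₀ : Measure X) (β : ℝ) (H : (ι → X) → ℝ) :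
    Measure (ProbabilityMeasure X) :=
  ((partitionFunction μ₀ β H)⁻¹ • (Measure.pi fun _ : ι => μ₀).withDensity
    fun x => ENNReal.ofReal (Real.exp (-β * H x))).map empirical

end Gibbs

end TorusLDP

end

/-! Write `N = n^d`. Each theta function equals `exp (-n d(p,x)²)` up to a factor bounded
independently of `n` (`exp_le_theta`, `theta_le`). Hence the permanent, like its tropical version,
equals `exp (-n min_σ ∑ d(p_i, x_{σ i})²)` up to a factor at most `N! C^N`. Since `N! ≤ N^N` and `N`
is polynomial in `n`, this factor is `exp (o(n^{d+1}))`, so both Hamiltonians are handled at once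
through `IsMatchingHamiltonian`.

Upper bound: a matching of the configuration with the lattice gives a transport map from `dx` to the
empirical measure, constant on the cells of side `1/n`, so `N` times the Wasserstein cost exceeds
the matching cost by at most `N d/n` (`W2sq_empirical_le`). Integrating the resulting pointwise
bound is enough.

Lower bound: from a nearly optimal plan `γ` for `ν`, draw one pair from each cell of the first
coordinate. The variance is `O(1/N)`, so some draw reproduces the cost and finitely many test
integrals. Moving the second points within balls of a fixed radius keeps this true, and full support
gives such a product of balls mass at least `c^N` (`exists_mass_lower_bound`). At speed `n^{d+1}`
the factor `c^N` is negligible, which is why no entropy of `μ₀` enters the rate.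

Finally `I` vanishes at `dx`, so the partition function is `exp (o(n^{d+1}))` and normalization
changes nothing. -/

open MeasureTheory Filter Topology
open scoped ENNReal

noncomputable section

namespace TorusLDP

/-! ### Weak topology on probability measures over a compact metric space. -/

section Weak

variable {X : Type*} [MetricSpace X] [MeasurableSpace X]

/-- Balls of a fixed radius have measure bounded below, for a measure of full support. -/
theorem exists_pos_le_measure_ball [CompactSpace X] (μ : Measure X) [μ.IsOpenPosMeasure] {δ : ℝ} (hδ : 0 < δ) :
    ∃ c : ℝ, 0 < c ∧ ∀ y, ENNReal.ofReal c ≤ μ (Metric.ball y δ) := by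
  obtain ⟨t, -, hfin, ht⟩ := finite_cover_balls_of_compact (isCompact_univ (X := X)) (half_pos hδ)
  have hpos : ∀ s : t, ∃ c : ℝ, 0 < c ∧ ENNReal.ofReal c ≤ μ (Metric.ball s.1 (δ / 2)) := by
    intro s
    have h := Metric.measure_ball_pos μ s.1 (half_pos hδ)
    obtain ⟨c, hc, hc'⟩ := ENNReal.lt_iff_exists_real_btwn.1 h
    exact ⟨c, ENNReal.ofReal_pos.1 hc'.1, hc'.2.le⟩
  choose c hc hcm using hpos
  have := hfin.fintype
  obtain ⟨ε, hε, hεe⟩ : ∃ ε : ℝ, 0 < ε ∧ ∀ f, ε ≤ c f := by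
    rcases isEmpty_or_nonempty t with h | h
    · exact ⟨1, one_pos, fun f => h.elim f⟩
    · obtain ⟨f, hf⟩ := Finite.exists_min c
      exact ⟨c f, hc f, hf⟩
  refine ⟨ε, hε, fun y => ?_⟩
  obtain ⟨s, hs, hys⟩ := Set.mem_iUnion₂.1 (ht (Set.mem_univ y))
  refine (ENNReal.ofReal_le_ofReal (hεe ⟨s, hs⟩)).trans ((hcm ⟨s, hs⟩).trans (measure_mono ?_))
  refine Metric.ball_subset_ball' ?_
  rw [Metric.mem_ball, dist_comm] at hys
  linarith

variable [BorelSpace X]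

/-- Finitely many integrals of continuous functions define a basis of neighbourhoods of the weak
topology. -/
theorem exists_finset_integral_nhds {ν : ProbabilityMeasure X} {O : Set (ProbabilityMeasure X)}
    (hO : O ∈ 𝓝 ν) :
    ∃ (F : Finset C(X, ℝ)) (ε : ℝ), 0 < ε ∧ ∀ ν' : ProbabilityMeasure X,
      (∀ f ∈ F, |∫ x, f x ∂(ν' : Measure X) - ∫ x, f x ∂(ν : Measure X)| < ε) → ν' ∈ O := by
  -- Weak convergence means convergence of all integrals, so `𝓝 ν` is bounded by these pullback
  -- filters; membership in their infimum involves only finitely many `f`.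
  have key : (⨅ f : C(X, ℝ), comap (fun ν' : ProbabilityMeasure X => ∫ x, f x ∂(ν' : Measure X))
      (𝓝 (∫ x, f x ∂(ν : Measure X)))) ≤ 𝓝 ν := by
    rw [← tendsto_id', ProbabilityMeasure.tendsto_iff_forall_integral_tendsto]
    intro f
    exact tendsto_comap.mono_left (iInf_le _ f.toContinuousMap)
  obtain ⟨I, hI, V, hV, hs⟩ := mem_iInf.1 (key hO)
  have hV' : ∀ f : I, ∃ ε : ℝ, 0 < ε ∧ ∀ ν' : ProbabilityMeasure X,
      |∫ x, f.1 x ∂(ν' : Measure X) - ∫ x, f.1 x ∂(ν : Measure X)| < ε → ν' ∈ V f := by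
    intro f
    obtain ⟨t, ht, htV⟩ := mem_comap.1 (hV f)
    obtain ⟨ε, hε, hb⟩ := Metric.mem_nhds_iff.1 ht
    exact ⟨ε, hε, fun ν' h => htV (hb (by simpa [Real.dist_eq] using h))⟩
  choose e he hev using hV'
  have := hI.fintype
  obtain ⟨ε, hε, hεe⟩ : ∃ ε : ℝ, 0 < ε ∧ ∀ f, ε ≤ e f := by
    rcases isEmpty_or_nonempty I with h | h
    · exact ⟨1, one_pos, fun f => h.elim f⟩
    · obtain ⟨f, hf⟩ := Finite.exists_min e
      exact ⟨e f, he f, hf⟩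
  refine ⟨hI.toFinset, ε, hε, fun ν' h => ?_⟩
  rw [hs]
  refine Set.mem_iInter.2 fun f => hev f ν' ((h f.1 ?_).trans_le (hεe f))
  simp

variable [CompactSpace X]

theorem measurable_integral_continuousMap (f : C(X, ℝ)) :
    Measurable fun ν : ProbabilityMeasure X => ∫ x, f x ∂(ν : Measure X) := by
  have h : ∀ g : C(X, ℝ),
      Measurable fun ν : ProbabilityMeasure X => ∫⁻ x, ENNReal.ofReal (g x) ∂(ν : Measure X) :=
    fun g => (Measure.measurable_lintegral (by fun_prop)).comp measurable_subtype_coe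
  have he : (fun ν : ProbabilityMeasure X => ∫ x, f x ∂(ν : Measure X)) =
      fun ν : ProbabilityMeasure X => (∫⁻ x, ENNReal.ofReal (f x) ∂(ν : Measure X)).toReal -
        (∫⁻ x, ENNReal.ofReal ((-f) x) ∂(ν : Measure X)).toReal := by
    ext ν
    exact integral_eq_lintegral_pos_part_sub_lintegral_neg_part
      (f.continuous.integrable_of_hasCompactSupport (HasCompactSupport.of_compactSpace _))
  rw [he]
  exact (h f).ennreal_toReal.sub (h (-f)).ennreal_toReal

/-- The σ-algebra on `ProbabilityMeasure X` is generated by evaluations on sets, not by the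
topology. Basic neighbourhoods are measurable through integrals, and countably many of them cover an
open set. -/
theorem measurableSet_of_isOpen {O : Set (ProbabilityMeasure X)} (hO : IsOpen O) :
    MeasurableSet O := by
  have h : ∀ ν : ProbabilityMeasure X, ∃ U : Set (ProbabilityMeasure X),
      ν ∈ O → IsOpen U ∧ MeasurableSet U ∧ ν ∈ U ∧ U ⊆ O := by
    intro ν
    by_cases hν : ν ∈ O
    · obtain ⟨F, ε, hε, h⟩ := exists_finset_integral_nhds (hO.mem_nhds hν)
      refine ⟨⋂ f ∈ F, (fun ν' : ProbabilityMeasure X => ∫ x, f x ∂(ν' : Measure X)) ⁻¹'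
        Metric.ball (∫ x, f x ∂(ν : Measure X)) ε, fun _ => ⟨?_, ?_, ?_, ?_⟩⟩
      · exact isOpen_biInter_finset fun f _ => Metric.isOpen_ball.preimage
          (ProbabilityMeasure.continuous_integral_continuousMap f)
      · exact F.measurableSet_biInter fun f _ =>
          measurable_integral_continuousMap f Metric.isOpen_ball.measurableSet
      · simp [hε]
      · intro ν' hν'
        refine h ν' fun f hf => ?_
        have := Set.mem_iInter₂.1 hν' f hf
        simpa [Real.dist_eq] using this
    · exact ⟨∅, fun h => absurd h hν⟩
  choose U hU using h
  obtain ⟨t, ht, hc⟩ := TopologicalSpace.isOpen_biUnion_countable O U fun ν hν => (hU ν hν).1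
  have : O = ⋃ ν ∈ t, U ν := by
    rw [hc.2]
    ext ν
    simp only [Set.mem_iUnion]
    exact ⟨fun h => ⟨ν, h, (hU ν h).2.2.1⟩, fun ⟨ν', h, h'⟩ => (hU ν' h).2.2.2 h'⟩
  rw [this]
  exact MeasurableSet.biUnion hc.1 fun ν hν => (hU ν (ht hν)).2.1

/-- The optimal transport cost for a continuous cost function is lower semicontinuous. -/
theorem lowerSemicontinuous_transportCost (μ : Measure X) [IsProbabilityMeasure μ]
    {c : X × X → ℝ} (hc : Continuous c) :
    LowerSemicontinuous fun ν : ProbabilityMeasure X =>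
      ⨅ γ ∈ {γ : Measure (X × X) |
        IsProbabilityMeasure γ ∧ γ.map Prod.fst = μ ∧ γ.map Prod.snd = (ν : Measure X)},
        ∫⁻ z, ENNReal.ofReal (c z) ∂γ := by
  rw [lowerSemicontinuous_iff_isClosed_preimage]
  intro y
  let cost : ProbabilityMeasure (X × X) → ℝ≥0∞ :=
    fun γ => ∫⁻ z, ENNReal.ofReal (c z) ∂(γ : Measure (X × X))
  let p₁ : ProbabilityMeasure (X × X) → ProbabilityMeasure X :=
    fun γ => γ.map (f := Prod.fst) measurable_fst.aemeasurable
  let p₂ : ProbabilityMeasure (X × X) → ProbabilityMeasure X :=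
    fun γ => γ.map (f := Prod.snd) measurable_snd.aemeasurable
  have hcost : Continuous cost :=
    ProbabilityMeasure.continuous_lintegral_continuousMap
      (⟨fun z => (c z).toNNReal, by fun_prop⟩ : C(X × X, NNReal))
  have hp₁ : Continuous p₁ := ProbabilityMeasure.continuous_map continuous_fst
  have hp₂ : Continuous p₂ := ProbabilityMeasure.continuous_map continuous_snd
  -- The sublevel set at `y` is the intersection over `z > y` of projections of the compact sets `K
  -- z`; no optimal plan is needed.
  let K : ℝ≥0∞ → Set (ProbabilityMeasure (X × X)) :=
    fun z => p₁ ⁻¹' {⟨μ, inferInstance⟩} ∩ cost ⁻¹' Set.Iic z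
  have hK : ∀ z, IsClosed (p₂ '' K z) := fun z =>
    (((isClosed_singleton.preimage hp₁).inter (isClosed_Iic.preimage hcost)).isCompact.image
      hp₂).isClosed
  have : (fun ν : ProbabilityMeasure X =>
      ⨅ γ ∈ {γ : Measure (X × X) |
        IsProbabilityMeasure γ ∧ γ.map Prod.fst = μ ∧ γ.map Prod.snd = (ν : Measure X)},
        ∫⁻ z, ENNReal.ofReal (c z) ∂γ) ⁻¹' Set.Iic y = ⋂ z ∈ Set.Ioi y, p₂ '' K z := by
    ext ν
    simp only [Set.mem_preimage, Set.mem_Iic, Set.mem_iInter, Set.mem_Ioi]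
    constructor
    · intro h z hz
      obtain ⟨γ, ⟨h₀, h₁, h₂⟩, h₃⟩ := by
        simpa only [iInf_lt_iff, exists_prop] using h.trans_lt hz
      exact ⟨⟨γ, h₀⟩, ⟨Subtype.ext h₁, h₃.le⟩, Subtype.ext h₂⟩
    · intro h
      refine le_of_forall_gt fun z hz => ?_
      obtain ⟨w, hyw, hwz⟩ := exists_between hz
      obtain ⟨γ, ⟨h₁, h₃⟩, h₂⟩ := h w hyw
      refine lt_of_le_of_lt (iInf₂_le (γ : Measure (X × X))
        ⟨inferInstance, congrArg Subtype.val h₁, congrArg Subtype.val h₂⟩) (lt_of_le_of_lt h₃ hwz)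
  rw [this]
  exact isClosed_biInter fun z _ => hK z

end Weak

/-! ### Stratified sampling by the second moment method. -/

section Sampling

open ProbabilityTheory

/-- Stratified sampling: one point from each of the cells of a partition into cells of equal
measure, such that the averages of given bounded functions are close to their integrals. -/
theorem exists_stratified_sample {Z ι κ : Type*} [MeasurableSpace Z] [Fintype ι] [Nonempty ι]
    (γ : Measure Z) [IsProbabilityMeasure γ] (T : Z → ι)
    (hT : ∀ i, MeasurableSet (T ⁻¹' {i})) (hγ : ∀ i, γ (T ⁻¹' {i}) = (Fintype.card ι : ℝ≥0∞)⁻¹)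
    (F : Finset κ) (f : κ → Z → ℝ) (hf : ∀ k, Measurable (f k)) {M : ℝ}
    (hM : ∀ k z, |f k z| ≤ M) :
    ∃ z : ι → Z, (∀ i, T (z i) = i) ∧
      ∑ k ∈ F, ((Fintype.card ι : ℝ)⁻¹ * ∑ i, f k (z i) - ∫ w, f k w ∂γ) ^ 2 ≤
        F.card * M ^ 2 / Fintype.card ι := by
  set N : ℝ := (Fintype.card ι : ℝ) with hN
  have hNpos : 0 < N := by simp [hN, Fintype.card_pos]
  -- The law of `γ` conditioned on each cell. The cells have equal mass, so these laws average to
  -- `γ` and the sample averages are unbiased.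
  let p : ι → Measure Z := fun i => γ[|T ⁻¹' {i}]
  have hp : ∀ i, IsProbabilityMeasure (p i) := fun i =>
    cond_isProbabilityMeasure (by rw [hγ]; simp)
  have hfp : ∀ k (m : Measure Z) [IsProbabilityMeasure m], MemLp (f k) 2 m := fun k m _ =>
    MemLp.of_bound (hf k).aestronglyMeasurable M (ae_of_all _ fun z => by simpa using hM k z)
  have hmean : ∀ k, N⁻¹ * ∑ i, ∫ w, f k w ∂(p i) = ∫ w, f k w ∂γ := by
    intro k
    have h1 : ∀ i, ∫ w, f k w ∂(p i) = N * ∫ w in T ⁻¹' {i}, f k w ∂γ := by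
      intro i
      simp only [p, ProbabilityTheory.cond, integral_smul_measure, hγ]
      simp [hN]
    simp_rw [h1]
    rw [← Finset.mul_sum, inv_mul_cancel_left₀ hNpos.ne', ← integral_iUnion_fintype hT]
    · have : (⋃ i, T ⁻¹' {i}) = Set.univ := by ext; simp
      rw [this, Measure.restrict_univ]
    · intro i j hij
      exact Disjoint.preimage _ (by simpa using hij)
    · exact fun i => ((hfp k γ).integrable one_le_two).integrableOn
  let S : κ → (ι → Z) → ℝ := fun k z => N⁻¹ * ∑ i, f k (z i)
  have hcomp : ∀ k i, MemLp (fun z : ι → Z => f k (z i)) 2 (Measure.pi p) := fun k i =>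
    MemLp.of_bound ((hf k).comp (measurable_pi_apply i)).aestronglyMeasurable M
      (ae_of_all _ fun z => by simpa using hM k (z i))
  have hSm : ∀ k, MemLp (S k) 2 (Measure.pi p) := fun k =>
    (memLp_finsetSum _ fun i _ => hcomp k i).const_mul _
  have hSE : ∀ k, ∫ z, S k z ∂(Measure.pi p) = ∫ w, f k w ∂γ := by
    intro k
    rw [← hmean k, integral_const_mul, integral_finsetSum _ fun i _ =>
      (hcomp k i).integrable one_le_two]
    congr 1
    refine Finset.sum_congr rfl fun i _ => ?_
    rw [← (measurePreserving_eval p i).map_eq, integral_map (measurable_pi_apply i).aemeasurable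
      (hf k).aestronglyMeasurable]
  have hvar : ∀ k, ∫ z, (S k z - ∫ w, f k w ∂γ) ^ 2 ∂(Measure.pi p) ≤ M ^ 2 / N := by
    intro k
    rw [← hSE k, ← variance_eq_integral (hSm k).aestronglyMeasurable.aemeasurable]
    have : S k = fun z => N⁻¹ * (∑ i, fun z : ι → Z => f k (z i)) z := by
      ext z; simp [S]
    rw [this, variance_const_mul, variance_sum_pi fun i => hfp k (p i)]
    have : ∑ i, variance (f k) (p i) ≤ ∑ i : ι, M ^ 2 := by
      refine Finset.sum_le_sum fun i _ => ?_
      refine (variance_le_expectation_sq (hf k).aestronglyMeasurable).trans ?_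
      have h2 : ∫ w, M ^ 2 ∂(p i) = M ^ 2 := by simp
      rw [← h2]
      refine integral_mono (hfp k (p i)).integrable_sq (integrable_const _) fun w => ?_
      exact sq_le_sq' (abs_le.1 (hM k w)).1 (abs_le.1 (hM k w)).2
    calc N⁻¹ ^ 2 * ∑ i, variance (f k) (p i) ≤ N⁻¹ ^ 2 * (N * M ^ 2) := by
          gcongr
          simpa [hN] using this
      _ = M ^ 2 / N := by field_simp
  have hint : ∀ k, Integrable (fun z => (S k z - ∫ w, f k w ∂γ) ^ 2) (Measure.pi p) := fun k =>
    ((hSm k).sub (memLp_const _)).integrable_sq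
  have hnull : (Measure.pi p) {z | ¬ ∀ i, T (z i) = i} = 0 := by
    change ∀ᵐ z ∂(Measure.pi p), ∀ i, T (z i) = i
    rw [ae_all_iff]
    intro i
    have : ∀ᵐ w ∂(p i), T w = i := ae_cond_mem (hT i)
    exact (measurePreserving_eval p i).quasiMeasurePreserving.ae this
  -- Some sample lies in the prescribed cells and does no worse than the expected total squared
  -- error.
  obtain ⟨z, hz, hle⟩ := exists_notMem_null_le_integral
    (integrable_finsetSum F fun k _ => hint k) hnull
  refine ⟨z, by simpa using hz, hle.trans ?_⟩
  rw [integral_finsetSum _ fun k _ => hint k]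
  refine (Finset.sum_le_sum fun k _ => hvar k).trans (le_of_eq ?_)
  rw [Finset.sum_const, nsmul_eq_mul]
  ring

end Sampling

/-! ### The squared distance of the torus in coordinates. -/

section Geometry

variable {d : ℕ}

theorem rep_mem_Ico (x : UnitAddTorus (Fin d)) (k : Fin d) : rep x k ∈ Set.Ico (0 : ℝ) 1 := by
  simpa [rep] using (AddCircle.equivIco (1 : ℝ) 0 (x k)).2

theorem norm_rep_sub_intVec_sq (x y : UnitAddTorus (Fin d)) (m : Fin d → ℤ) :
    ‖rep x - rep y - intVec m‖ ^ 2 = ∑ k, (rep x k - rep y k - m k) ^ 2 := by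
  rw [EuclideanSpace.norm_sq_eq]
  simp [intVec]

theorem norm_sub_eq_rep (x y : UnitAddTorus (Fin d)) (k : Fin d) :
    ‖x k - y k‖ = |rep x k - rep y k - round (rep x k - rep y k)| := by
  rw [← UnitAddCircle.norm_eq, AddCircle.coe_sub, coe_rep, coe_rep]

theorem sum_norm_sq_le (x y : UnitAddTorus (Fin d)) (m : Fin d → ℤ) :
    ∑ k, ‖x k - y k‖ ^ 2 ≤ ‖rep x - rep y - intVec m‖ ^ 2 := by
  rw [norm_rep_sub_intVec_sq]
  refine Finset.sum_le_sum fun k _ => ?_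
  rw [norm_sub_eq_rep, sq_abs]
  exact sq_le_sq.2 (round_le _ _)

theorem sum_norm_sq_eq (x y : UnitAddTorus (Fin d)) :
    ∑ k, ‖x k - y k‖ ^ 2 =
      ‖rep x - rep y - intVec fun k => round (rep x k - rep y k)‖ ^ 2 := by
  rw [norm_rep_sub_intVec_sq]
  exact Finset.sum_congr rfl fun k _ => by rw [norm_sub_eq_rep, sq_abs]

/-- The infimum over `m` separates into coordinates and is attained by rounding each of them. -/
theorem sqDist_eq_sum (x y : UnitAddTorus (Fin d)) : sqDist x y = ∑ k, ‖x k - y k‖ ^ 2 := by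
  refine le_antisymm ?_ (le_ciInf fun m => sum_norm_sq_le x y m)
  rw [sum_norm_sq_eq]
  exact ciInf_le ⟨0, by rintro _ ⟨m, rfl⟩; positivity⟩ _

theorem continuous_sqDist : Continuous fun z : UnitAddTorus (Fin d) × UnitAddTorus (Fin d) =>
    sqDist z.1 z.2 := by
  simp_rw [sqDist_eq_sum]
  fun_prop

theorem sqDist_nonneg (x y : UnitAddTorus (Fin d)) : 0 ≤ sqDist x y := by
  rw [sqDist_eq_sum]
  positivity

theorem sqDist_self (x : UnitAddTorus (Fin d)) : sqDist x x = 0 := by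
  simp [sqDist_eq_sum]

theorem norm_unitAddCircle_le (a : UnitAddCircle) : ‖a‖ ≤ 1 / 2 := by
  simpa using AddCircle.norm_le_half_period (1 : ℝ) one_ne_zero (x := a)

theorem sqDist_le (x y : UnitAddTorus (Fin d)) : sqDist x y ≤ d := by
  rw [sqDist_eq_sum]
  refine (Finset.sum_le_card_nsmul _ _ 1 fun k _ => ?_).trans (by simp)
  have := norm_unitAddCircle_le (x k - y k)
  have := norm_nonneg (x k - y k)
  nlinarith

theorem sqDist_comm (x y : UnitAddTorus (Fin d)) : sqDist x y = sqDist y x := by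
  simp_rw [sqDist_eq_sum]
  exact Finset.sum_congr rfl fun k _ => by rw [norm_sub_rev]

/-- Circle norms are at most `1/2`, so `a² - b² = (a - b)(a + b) ≤ a - b` whenever `b ≤ a`. -/
theorem sqDist_le_add (x x' y : UnitAddTorus (Fin d)) :
    sqDist x y ≤ sqDist x' y + ∑ k, ‖x k - x' k‖ := by
  rw [sqDist_eq_sum, sqDist_eq_sum, ← Finset.sum_add_distrib]
  refine Finset.sum_le_sum fun k _ => ?_
  have h1 := norm_unitAddCircle_le (x k - y k)
  have h2 := norm_unitAddCircle_le (x' k - y k)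
  have h3 : ‖x k - y k‖ ≤ ‖x' k - y k‖ + ‖x k - x' k‖ := by
    have := norm_add_le (x' k - y k) (x k - x' k)
    rwa [show x' k - y k + (x k - x' k) = x k - y k by abel] at this
  have := norm_nonneg (x k - y k)
  have := norm_nonneg (x' k - y k)
  have := norm_nonneg (x k - x' k)
  nlinarith

end Geometry

/-! ### Gaussian bounds for theta functions, uniform in `n`. -/

section Theta

variable {d : ℕ}

theorem summable_prod_int {f : ℤ → ℝ} (hf : Summable f) (h0 : ∀ m, 0 ≤ f m) (d : ℕ) :
    Summable fun m : Fin d → ℤ => ∏ k, f (m k) := by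
  induction d with
  | zero => exact Summable.of_finite
  | succ d ih =>
    rw [← (Fin.consEquiv fun _ => ℤ).summable_iff]
    have := hf.mul_of_nonneg ih h0 fun m => Finset.prod_nonneg fun k _ => h0 _
    refine this.congr fun m => ?_
    simp [Fin.prod_univ_succ, Fin.consEquiv]

theorem summable_exp_neg_half_sq : Summable fun m : ℤ => Real.exp (-(m : ℝ) ^ 2 / 2) := by
  have h : Summable fun n : ℕ => Real.exp (-(n : ℝ) ^ 2 / 2) := by
    have := Real.summable_exp_nat_mul_iff.2 (show (-(1 / 2) : ℝ) < 0 by norm_num)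
    refine this.of_nonneg_of_le (fun n => (Real.exp_pos _).le) fun n => ?_
    refine Real.exp_le_exp.2 ?_
    rcases Nat.eq_zero_or_pos n with rfl | hn
    · simp
    · have : (1 : ℝ) ≤ n := by exact_mod_cast hn
      nlinarith
  refine Summable.of_nat_of_neg ?_ ?_ <;> simpa using h

/-- The constant in the Gaussian upper bound of the theta functions. -/
def thetaConst (d : ℕ) : ℝ :=
  Real.exp (2 * d) * ∑' m : Fin d → ℤ, ∏ k, Real.exp (-(m k : ℝ) ^ 2 / 2)

/-- With `q` the squared norm and `D` the squared distance, `n q ≥ n D + (q - D)`. The spare `q - D`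
gives summability in `m` with a constant free of `n`: `q ≥ ∑ m²/2 - d` and `D ≤ d`, whence `2 * d`.
-/
theorem exp_le_gaussian {n : ℕ} (hn : 1 ≤ n) (p x : UnitAddTorus (Fin d)) (m : Fin d → ℤ) :
    Real.exp (-(n : ℝ) * ‖rep x - rep p - intVec m‖ ^ 2) ≤
      Real.exp (2 * d) * Real.exp (-(n : ℝ) * sqDist p x) *
        ∏ k, Real.exp (-(m k : ℝ) ^ 2 / 2) := by
  rw [← Real.exp_sum, ← Real.exp_add, ← Real.exp_add, Real.exp_le_exp]
  have h1 : sqDist p x ≤ ‖rep x - rep p - intVec m‖ ^ 2 := by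
    rw [sqDist_comm, sqDist_eq_sum]
    exact sum_norm_sq_le x p m
  have h2 : ∑ k, (m k : ℝ) ^ 2 / 2 - d ≤ ‖rep x - rep p - intVec m‖ ^ 2 := by
    rw [norm_rep_sub_intVec_sq]
    have : (d : ℝ) = ∑ k : Fin d, 1 := by simp
    rw [this, ← Finset.sum_sub_distrib]
    refine Finset.sum_le_sum fun k _ => ?_
    have hx := rep_mem_Ico x k
    have hp := rep_mem_Ico p k
    set a := rep x k - rep p k
    have ha : a ^ 2 ≤ 1 := by
      have : |a| ≤ 1 := abs_le.2 ⟨by linarith [hx.1, hp.2], by linarith [hx.2, hp.1]⟩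
      exact (sq_le_one_iff_abs_le_one a).2 this
    nlinarith [sq_nonneg (2 * a - m k)]
  have h3 := sqDist_le p x
  have h4 : (1 : ℝ) ≤ n := by exact_mod_cast hn
  have h5 : ∑ k, -(m k : ℝ) ^ 2 / 2 = -∑ k, (m k : ℝ) ^ 2 / 2 := by
    rw [← Finset.sum_neg_distrib]
    exact Finset.sum_congr rfl fun k _ => by ring
  rw [h5]
  nlinarith [mul_nonneg (sub_nonneg.2 h4) (sub_nonneg.2 h1)]

theorem summable_gaussian (d : ℕ) :
    Summable fun m : Fin d → ℤ => ∏ k, Real.exp (-(m k : ℝ) ^ 2 / 2) :=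
  summable_prod_int summable_exp_neg_half_sq (fun _ => (Real.exp_pos _).le) d

theorem summable_theta {n : ℕ} (hn : 1 ≤ n) (p x : UnitAddTorus (Fin d)) :
    Summable fun m : Fin d → ℤ => Real.exp (-(n : ℝ) * ‖rep x - rep p - intVec m‖ ^ 2) :=
  ((summable_gaussian d).mul_left _).of_nonneg_of_le (fun _ => (Real.exp_pos _).le)
    (exp_le_gaussian hn p x)

theorem exp_le_theta {n : ℕ} (hn : 1 ≤ n) (p x : UnitAddTorus (Fin d)) :
    Real.exp (-(n : ℝ) * sqDist p x) ≤ theta n (rep p) (rep x) := by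
  rw [sqDist_comm, sqDist_eq_sum, sum_norm_sq_eq]
  exact (summable_theta hn p x).le_tsum _ fun _ _ => (Real.exp_pos _).le

theorem theta_le {n : ℕ} (hn : 1 ≤ n) (p x : UnitAddTorus (Fin d)) :
    theta n (rep p) (rep x) ≤ thetaConst d * Real.exp (-(n : ℝ) * sqDist p x) := by
  refine ((summable_theta hn p x).tsum_le_tsum (exp_le_gaussian hn p x)
    ((summable_gaussian d).mul_left _)).trans (le_of_eq ?_)
  rw [tsum_mul_left, thetaConst]
  ring

theorem thetaConst_pos (d : ℕ) : 0 < thetaConst d := by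
  refine mul_pos (Real.exp_pos _) ((summable_gaussian d).tsum_pos (fun m => ?_) 0 ?_)
  · positivity
  · positivity

/-- The lattice points of the torus. -/
def gridTorus (n : ℕ) (i : Fin d → Fin n) : UnitAddTorus (Fin d) :=
  fun k => (((i k : ℕ) : ℝ) / n : ℝ)

theorem rep_gridTorus (n : ℕ) (i : Fin d → Fin n) : rep (gridTorus n i) = gridPoint n i := by
  ext k
  have hn : (0 : ℝ) < n := by exact_mod_cast (i k).pos
  have h : ((i k : ℕ) : ℝ) / n < 1 := by
    rw [div_lt_one hn]
    exact_mod_cast (i k).2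
  simp only [rep, gridTorus, gridPoint, AddCircle.coe_equivIco_mk_apply]
  rw [div_one, mul_one, Int.fract_eq_self.2 ⟨by positivity, h⟩]

theorem thetaMatrix_apply (n : ℕ) (x : (Fin d → Fin n) → UnitAddTorus (Fin d))
    (i j : Fin d → Fin n) :
    thetaMatrix n x i j = theta n (rep (gridTorus n i)) (rep (x j)) := by
  rw [rep_gridTorus]
  rfl

end Theta

/-! ### Elementary bounds for permanents. -/

section Permanent

variable {ι : Type*} [Fintype ι] [DecidableEq ι] (A : Matrix ι ι ℝ)

theorem prod_diag_le_permanent (hA : ∀ i j, 0 ≤ A i j) : ∏ i, A i i ≤ A.permanent :=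
  Finset.single_le_sum (f := fun σ : Equiv.Perm ι => ∏ i, A (σ i) i)
    (fun _ _ => Finset.prod_nonneg fun _ _ => hA _ _) (Finset.mem_univ 1)

theorem permanent_le {b : ℝ} (hb : ∀ σ : Equiv.Perm ι, ∏ i, A i (σ i) ≤ b) :
    A.permanent ≤ (Fintype.card ι).factorial * b := by
  rw [Matrix.permanent, ← Fintype.card_perm, ← nsmul_eq_mul, ← Finset.card_univ]
  refine Finset.sum_le_card_nsmul _ _ _ fun σ _ => le_trans (le_of_eq ?_) (hb σ⁻¹)
  rw [← Equiv.prod_comp σ fun i => A i (σ⁻¹ i)]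
  simp

end Permanent

/-! ### Both Hamiltonians compared with the matching cost. -/

section Hamiltonians

variable {d : ℕ}

/-- The total cost of matching the points of a configuration with the lattice points. -/
def matchingCost (n : ℕ) (x : (Fin d → Fin n) → UnitAddTorus (Fin d)) : ℝ :=
  ∑ i, sqDist (gridTorus n i) (x i)

theorem exp_matchingCost_le_prod {n : ℕ} (hn : 1 ≤ n) (x : (Fin d → Fin n) → UnitAddTorus (Fin d))
    (σ : Equiv.Perm (Fin d → Fin n)) :
    Real.exp (-(n : ℝ) * matchingCost n (x ∘ σ)) ≤ ∏ i, thetaMatrix n x i (σ i) := by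
  rw [matchingCost, Finset.mul_sum, Real.exp_sum]
  refine Finset.prod_le_prod (fun i _ => (Real.exp_pos _).le) fun i _ => ?_
  rw [thetaMatrix_apply]
  exact exp_le_theta hn _ _

theorem prod_le_exp_matchingCost {n : ℕ} (hn : 1 ≤ n) (x : (Fin d → Fin n) → UnitAddTorus (Fin d))
    (σ : Equiv.Perm (Fin d → Fin n)) :
    ∏ i, thetaMatrix n x i (σ i) ≤
      thetaConst d ^ Fintype.card (Fin d → Fin n) *
        Real.exp (-(n : ℝ) * matchingCost n (x ∘ σ)) := by
  rw [matchingCost, Finset.mul_sum, Real.exp_sum, ← Finset.card_univ, ← Finset.prod_const,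
    ← Finset.prod_mul_distrib]
  refine Finset.prod_le_prod (fun i _ => ?_) fun i _ => ?_
  · rw [thetaMatrix_apply]
    exact (Real.exp_pos _).le.trans (exp_le_theta hn _ _)
  · rw [thetaMatrix_apply]
    exact theta_le hn _ _

/-- The Boltzmann factor `exp (-n H)` is comparable, up to subexponential factors, to the
exponential of the least matching cost. -/
structure IsMatchingHamiltonian (n : ℕ)
    (H : ((Fin d → Fin n) → UnitAddTorus (Fin d)) → ℝ) : Prop where
  exp_le : ∀ x, Real.exp (-(n : ℝ) * matchingCost n x) ≤ Real.exp (-(n : ℝ) * H x)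
  le_exp : ∀ x B, (∀ σ : Equiv.Perm (Fin d → Fin n), B ≤ matchingCost n (x ∘ σ)) →
    Real.exp (-(n : ℝ) * H x) ≤ (Fintype.card (Fin d → Fin n)).factorial *
      thetaConst d ^ Fintype.card (Fin d → Fin n) * Real.exp (-(n : ℝ) * B)

/-- `A` stands for either kind of permanent. The identity permutation suffices for the lower bound;
the factorial, superfluous in the tropical case, is harmless at the speed in question. -/
theorem isMatchingHamiltonian_of_log {n : ℕ} (hn : 1 ≤ n)
    (A : ((Fin d → Fin n) → UnitAddTorus (Fin d)) → ℝ)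
    (h1 : ∀ x, ∏ i, thetaMatrix n x i i ≤ A x)
    (h2 : ∀ x b, (∀ σ : Equiv.Perm (Fin d → Fin n), ∏ i, thetaMatrix n x i (σ i) ≤ b) →
      A x ≤ (Fintype.card (Fin d → Fin n)).factorial * b) :
    IsMatchingHamiltonian n fun x => -(1 / (n : ℝ)) * Real.log (A x) := by
  have h3 : ∀ x, Real.exp (-(n : ℝ) * matchingCost n x) ≤ A x := fun x =>
    (exp_matchingCost_le_prod hn x 1).trans (h1 x)
  have h4 : ∀ x, Real.exp (-(n : ℝ) * (-(1 / (n : ℝ)) * Real.log (A x))) = A x := by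
    intro x
    have : (n : ℝ) ≠ 0 := by positivity
    rw [show -(n : ℝ) * (-(1 / (n : ℝ)) * Real.log (A x)) = Real.log (A x) by field_simp,
      Real.exp_log ((Real.exp_pos _).trans_le (h3 x))]
  refine ⟨fun x => (h3 x).trans (h4 x).ge, fun x B hB => (h4 x).le.trans ?_⟩
  rw [mul_assoc]
  refine h2 x _ fun σ => (prod_le_exp_matchingCost hn x σ).trans ?_
  have := (thetaConst_pos d).le
  have h5 : (0 : ℝ) ≤ n := by positivity
  refine mul_le_mul_of_nonneg_left (Real.exp_le_exp.2 ?_) (by positivity)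
  nlinarith [mul_le_mul_of_nonneg_left (hB σ) h5]

theorem isMatchingHamiltonian_hamiltonian {n : ℕ} (hn : 1 ≤ n) :
    IsMatchingHamiltonian n (hamiltonian (d := d) n) := by
  have hpos : ∀ (x : (Fin d → Fin n) → UnitAddTorus (Fin d)) i j, 0 ≤ thetaMatrix n x i j := by
    intro x i j
    rw [thetaMatrix_apply]
    exact (Real.exp_pos _).le.trans (exp_le_theta hn _ _)
  exact isMatchingHamiltonian_of_log hn _ (fun x => prod_diag_le_permanent _ (hpos x))
    fun x b hb => permanent_le _ hb

theorem isMatchingHamiltonian_tropicalHamiltonian {n : ℕ} (hn : 1 ≤ n) :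
    IsMatchingHamiltonian n (tropicalHamiltonian (d := d) n) := by
  refine isMatchingHamiltonian_of_log hn _ (fun x => ?_) fun x b hb => ?_
  · exact le_ciSup (f := fun σ : Equiv.Perm (Fin d → Fin n) => ∏ i, thetaMatrix n x i (σ i))
      (Set.finite_range _).bddAbove 1
  · have hb0 : 0 ≤ b := (Real.exp_pos _).le.trans ((exp_matchingCost_le_prod hn x 1).trans (hb 1))
    refine (ciSup_le hb).trans (le_mul_of_one_le_left hb0 ?_)
    exact_mod_cast Nat.one_le_iff_ne_zero.2 (Nat.factorial_ne_zero _)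

end Hamiltonians

/-! ### Cells of side `1/n`, and transport built from a matching. -/

section Cells

variable {d : ℕ}

instance : IsProbabilityMeasure (volume : Measure (UnitAddTorus (Fin d))) := by
  have : IsProbabilityMeasure (volume : Measure UnitAddCircle) :=
    ⟨UnitAddCircle.measure_univ⟩
  rw [volume_pi]
  infer_instance

/-- The index of the cell of side `1/n` that contains a point. -/
def cell {n : ℕ} (hn : 0 < n) (t : UnitAddTorus (Fin d)) : Fin d → Fin n := fun k =>
  ⟨⌊(n : ℝ) * rep t k⌋₊, by
    have h := rep_mem_Ico t k
    have hn' : (0 : ℝ) < n := by exact_mod_cast hn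
    rw [Nat.floor_lt (mul_nonneg hn'.le h.1)]
    nlinarith [h.2]⟩

theorem cell_preimage {n : ℕ} (hn : 0 < n) (i : Fin d → Fin n) :
    cell hn ⁻¹' {i} = Set.pi Set.univ fun k => {a : UnitAddCircle |
      ⌊(n : ℝ) * (AddCircle.equivIco (1 : ℝ) 0 a : ℝ)⌋₊ = (i k : ℕ)} := by
  ext t
  simp only [Set.mem_preimage, Set.mem_singleton_iff, funext_iff, Set.mem_pi, Set.mem_univ,
    true_imp_iff, Set.mem_ofPred_eq, Fin.ext_iff]
  rfl

theorem measurableSet_arc (n i : ℕ) : MeasurableSet {a : UnitAddCircle |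
    ⌊(n : ℝ) * (AddCircle.equivIco (1 : ℝ) 0 a : ℝ)⌋₊ = i} := by
  have h : Measurable fun a : UnitAddCircle => (AddCircle.equivIco (1 : ℝ) 0 a : ℝ) :=
    measurable_subtype_coe.comp (AddCircle.measurableEquivIco (1 : ℝ) 0).measurable
  exact (Nat.measurable_floor.comp (h.const_mul _)) (measurableSet_singleton i)

theorem volume_arc {n i : ℕ} (hi : i < n) : volume {a : UnitAddCircle |
    ⌊(n : ℝ) * (AddCircle.equivIco (1 : ℝ) 0 a : ℝ)⌋₊ = i} = (n : ℝ≥0∞)⁻¹ := by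
  have hn : (0 : ℝ) < n := by exact_mod_cast (Nat.zero_le i).trans_lt hi
  have hin : (i : ℝ) + 1 ≤ n := by exact_mod_cast hi
  rw [← (UnitAddCircle.measurePreserving_mk 0).measure_preimage
    (measurableSet_arc n i).nullMeasurableSet,
    -- The quotient map preserves measure from `Ioc`, while `equivIco` takes representatives in
    -- `Ico`; the two intervals differ by a null set.
    ← Measure.restrict_congr_set (Ico_ae_eq_Ioc (μ := (volume : Measure ℝ)) (a := 0) (b := 0 + 1)),
    Measure.restrict_apply (measurableSet_preimage AddCircle.measurable_mk' (measurableSet_arc n i))]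
  have : (QuotientAddGroup.mk ⁻¹' {a : UnitAddCircle |
      ⌊(n : ℝ) * (AddCircle.equivIco (1 : ℝ) 0 a : ℝ)⌋₊ = i}) ∩ Set.Ico (0 : ℝ) (0 + 1) =
      Set.Ico ((i : ℝ) / n) ((i + 1 : ℝ) / n) := by
    ext s
    have hs : ∀ h : s ∈ Set.Ico (0 : ℝ) 1,
        (AddCircle.equivIco (1 : ℝ) 0 (s : UnitAddCircle) : ℝ) = s := by
      intro h
      rw [AddCircle.coe_equivIco_mk_apply, div_one, mul_one, Int.fract_eq_self.2 h]
    constructor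
    · rintro ⟨h1, h2⟩
      rw [zero_add] at h2
      change ⌊(n : ℝ) * (AddCircle.equivIco (1 : ℝ) 0 (s : UnitAddCircle) : ℝ)⌋₊ = i at h1
      rw [hs h2, Nat.floor_eq_iff (mul_nonneg hn.le h2.1)] at h1
      rw [Set.mem_Ico, div_le_iff₀ hn, lt_div_iff₀ hn, mul_comm s]
      exact h1
    · intro h
      rw [Set.mem_Ico, div_le_iff₀ hn, lt_div_iff₀ hn, mul_comm s] at h
      have h2 : s ∈ Set.Ico (0 : ℝ) 1 := by
        constructor
        · have : (0 : ℝ) ≤ i := by positivity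
          nlinarith [h.1]
        · nlinarith [h.2]
      refine ⟨?_, by rwa [zero_add]⟩
      change ⌊(n : ℝ) * (AddCircle.equivIco (1 : ℝ) 0 (s : UnitAddCircle) : ℝ)⌋₊ = i
      rw [hs h2, Nat.floor_eq_iff (mul_nonneg hn.le h2.1)]
      exact h
  rw [this, Real.volume_Ico, ← sub_div, add_sub_cancel_left, one_div,
    ENNReal.ofReal_inv_of_pos hn, ENNReal.ofReal_natCast]

theorem measurableSet_cell {n : ℕ} (hn : 0 < n) (i : Fin d → Fin n) :
    MeasurableSet (cell hn ⁻¹' {i}) := by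
  rw [cell_preimage]
  exact MeasurableSet.univ_pi fun k => measurableSet_arc n _

theorem measurable_cell {n : ℕ} (hn : 0 < n) : Measurable (cell (d := d) hn) :=
  measurable_to_countable' (measurableSet_cell hn)

theorem volume_cell {n : ℕ} (hn : 0 < n) (i : Fin d → Fin n) :
    volume (cell hn ⁻¹' {i}) = (Fintype.card (Fin d → Fin n) : ℝ≥0∞)⁻¹ := by
  rw [cell_preimage, volume_pi_pi]
  simp [volume_arc, ENNReal.inv_pow]

theorem norm_sub_gridTorus_cell_le {n : ℕ} (hn : 0 < n) (t : UnitAddTorus (Fin d)) (k : Fin d) :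
    ‖t k - gridTorus n (cell hn t) k‖ ≤ 1 / n := by
  have hn' : (0 : ℝ) < n := by exact_mod_cast hn
  rw [← coe_rep t k, gridTorus, ← AddCircle.coe_sub, UnitAddCircle.norm_eq]
  refine (round_le _ 0).trans ?_
  have h0 := mul_nonneg hn'.le (rep_mem_Ico t k).1
  have h1 := Nat.floor_le h0
  have h2 := Nat.lt_floor_add_one ((n : ℝ) * rep t k)
  have h3 : rep t k - ((cell hn t k : ℕ) : ℝ) / n =
      ((n : ℝ) * rep t k - (⌊(n : ℝ) * rep t k⌋₊ : ℝ)) / n := by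
    simp only [cell]
    field_simp
  rw [Int.cast_zero, sub_zero, h3, abs_of_nonneg (div_nonneg (by linarith) hn'.le)]
  gcongr
  linarith

theorem sum_norm_sub_gridTorus_cell_le {n : ℕ} (hn : 0 < n) (t : UnitAddTorus (Fin d)) :
    ∑ k, ‖t k - gridTorus n (cell hn t) k‖ ≤ d / n := by
  refine (Finset.sum_le_card_nsmul _ _ _ fun k _ => norm_sub_gridTorus_cell_le hn t k).trans ?_
  simp [div_eq_mul_inv]

/-- Any matching of a configuration with the lattice points bounds the Wasserstein distance of its
empirical measure to the uniform measure. -/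
theorem W2sq_empirical_le {n : ℕ} (hn : 0 < n) [Nonempty (Fin d → Fin n)]
    (x : (Fin d → Fin n) → UnitAddTorus (Fin d)) (σ : Equiv.Perm (Fin d → Fin n)) :
    W2sq volume (empirical x : Measure (UnitAddTorus (Fin d))) ≤
      ENNReal.ofReal ((Fintype.card (Fin d → Fin n) : ℝ)⁻¹ * matchingCost n (x ∘ σ) + d / n) := by
  set N : ℝ := (Fintype.card (Fin d → Fin n) : ℝ) with hN
  -- Each cell is sent to the point matched with its corner. The cells have mass `1/N`, so `S`
  -- pushes `dx` to the empirical measure.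
  let S : UnitAddTorus (Fin d) → UnitAddTorus (Fin d) := fun t => x (σ (cell hn t))
  have hy : Measurable fun i => x (σ i) := measurable_of_finite _
  have hS : Measurable S := hy.comp (measurable_cell hn)
  have hmap : (volume : Measure (UnitAddTorus (Fin d))).map (cell hn) =
      (Fintype.card (Fin d → Fin n) : ℝ≥0∞)⁻¹ • Measure.count := by
    refine Measure.ext_of_singleton fun i => ?_
    rw [Measure.map_apply (measurable_cell hn) (measurableSet_singleton i), volume_cell]
    simp
  have hSmap : (volume : Measure (UnitAddTorus (Fin d))).map S =
      (empirical x : Measure (UnitAddTorus (Fin d))) := by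
    rw [show S = (fun i => x (σ i)) ∘ cell hn from rfl,
      ← Measure.map_map hy (measurable_cell hn), hmap, Measure.map_smul]
    change _ = (Fintype.card (Fin d → Fin n) : ℝ≥0∞)⁻¹ • ∑ i, Measure.dirac (x i)
    rw [← Equiv.sum_comp σ fun i => Measure.dirac (x i), Measure.count, Measure.sum_fintype]
    congr 1
    rw [← Measure.mapₗ_apply_of_measurable hy, map_sum]
    refine Finset.sum_congr rfl fun i _ => ?_
    rw [Measure.mapₗ_apply_of_measurable hy, Measure.map_dirac' hy]
  have hg : Measurable fun t : UnitAddTorus (Fin d) => (t, S t) := measurable_id.prodMk hS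
  have hcont := continuous_sqDist (d := d)
  have hfst : ((volume : Measure (UnitAddTorus (Fin d))).map fun t => (t, S t)).map Prod.fst =
      volume := by
    rw [Measure.map_map measurable_fst hg]
    exact Measure.map_id
  have hsnd : ((volume : Measure (UnitAddTorus (Fin d))).map fun t => (t, S t)).map Prod.snd =
      (empirical x : Measure (UnitAddTorus (Fin d))) := by
    rw [Measure.map_map measurable_snd hg]
    exact hSmap
  refine (iInf₂_le _ ⟨Measure.isProbabilityMeasure_map hg.aemeasurable, hfst, hsnd⟩).trans ?_
  rw [lintegral_map (by fun_prop) hg]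
  let G : (Fin d → Fin n) → ℝ≥0∞ := fun i =>
    ENNReal.ofReal (sqDist (gridTorus n i) (x (σ i)) + d / n)
  have hle : ∀ t, ENNReal.ofReal (sqDist t (S t)) ≤ G (cell hn t) := by
    intro t
    refine ENNReal.ofReal_le_ofReal ((sqDist_le_add _ (gridTorus n (cell hn t)) _).trans ?_)
    gcongr
    exact sum_norm_sub_gridTorus_cell_le hn t
  refine (lintegral_mono hle).trans ?_
  rw [← lintegral_map (f := G) (measurable_of_finite _) (measurable_cell hn), hmap,
    lintegral_smul_measure, lintegral_count, tsum_fintype, ← ENNReal.ofReal_sum_of_nonneg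
      fun i _ => add_nonneg (sqDist_nonneg _ _) (by positivity), Finset.sum_add_distrib,
    smul_eq_mul]
  have hNpos : 0 < N := Nat.cast_pos.2 Fintype.card_pos
  rw [show (Fintype.card (Fin d → Fin n) : ℝ≥0∞)⁻¹ = ENNReal.ofReal N⁻¹ by
    rw [ENNReal.ofReal_inv_of_pos hNpos, hN, ENNReal.ofReal_natCast],
    ← ENNReal.ofReal_mul (by positivity)]
  refine ENNReal.ofReal_le_ofReal (le_of_eq ?_)
  rw [mul_add, Finset.sum_const, Finset.card_univ, nsmul_eq_mul, ← hN,
    inv_mul_cancel_left₀ hNpos.ne']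
  rfl

end Cells

/-! ### Lower bound for the mass near a given measure. -/

section LowerBound

variable {d : ℕ}

theorem eventually_exists_sample (γ : Measure (UnitAddTorus (Fin d) × UnitAddTorus (Fin d)))
    [IsProbabilityMeasure γ] (hγ : γ.map Prod.fst = volume) {κ : Type*} [Fintype κ]
    (f : κ → C(UnitAddTorus (Fin d) × UnitAddTorus (Fin d), ℝ)) {ε : ℝ} (hε : 0 < ε) :
    ∀ᶠ n : ℕ in atTop,
      ∃ z : (Fin d → Fin (n + 1)) → UnitAddTorus (Fin d) × UnitAddTorus (Fin d),
        (∀ i, cell n.succ_pos (z i).1 = i) ∧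
        ∀ k, |(Fintype.card (Fin d → Fin (n + 1)) : ℝ)⁻¹ * ∑ i, f k (z i) - ∫ w, f k w ∂γ| <
          ε := by
  rcases Nat.eq_zero_or_pos d with rfl | hd
  -- For `d = 0` the number of cells stays `1`, so the variance bound does not decay, but the torus
  -- is a single point and the averages are exact.
  · refine Eventually.of_forall fun n => ⟨fun _ => 0, fun i => Subsingleton.elim _ _, fun k => ?_⟩
    have : ∀ w, f k w = f k 0 := fun w => congrArg _ (Subsingleton.elim _ _)
    simp [this, hε]
  · set M : ℝ := ∑ k, ‖f k‖
    have hM : ∀ k z, |f k z| ≤ M := fun k z =>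
      ((f k).norm_coe_le_norm z).trans
        (Finset.single_le_sum (f := fun k => ‖f k‖) (fun k _ => norm_nonneg _) (Finset.mem_univ k))
    obtain ⟨m, hm⟩ := exists_nat_gt (Fintype.card κ * M ^ 2 / ε ^ 2)
    filter_upwards [eventually_ge_atTop m] with n hn
    obtain ⟨z, hz, hle⟩ := exists_stratified_sample γ (fun w => cell n.succ_pos w.1)
      (fun i => measurable_fst (measurableSet_cell n.succ_pos i))
      (fun i => by
        rw [← volume_cell n.succ_pos i, ← hγ, Measure.map_apply measurable_fst
          (measurableSet_cell n.succ_pos i)]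
        rfl)
      Finset.univ (fun k w => f k w) (fun k => (f k).measurable) hM
    refine ⟨z, hz, fun k => ?_⟩
    have h1 := (Finset.single_le_sum (f := fun k => ((Fintype.card (Fin d → Fin (n + 1)) : ℝ)⁻¹ *
      ∑ i, f k (z i) - ∫ w, f k w ∂γ) ^ 2) (fun k _ => sq_nonneg _) (Finset.mem_univ k)).trans hle
    refine abs_lt_of_sq_lt_sq (h1.trans_lt ?_) hε.le
    have hN : (m : ℝ) < Fintype.card (Fin d → Fin (n + 1)) := by
      have : m < Fintype.card (Fin d → Fin (n + 1)) := by
        rw [Fintype.card_fun, Fintype.card_fin, Fintype.card_fin]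
        exact (Nat.lt_succ_of_le hn).trans_le (Nat.le_self_pow hd.ne' _)
      exact_mod_cast this
    have hN0 : (0 : ℝ) < Fintype.card (Fin d → Fin (n + 1)) := (Nat.cast_nonneg m).trans_lt hN
    rw [div_lt_iff₀ (by positivity)] at hm
    rw [div_lt_iff₀ hN0, Finset.card_univ]
    nlinarith [pow_pos hε 2]

/-- A product of balls of fixed radius on which averages over the matched pairs are close to the
integrals against a given transport plan. -/
theorem exists_box (γ : Measure (UnitAddTorus (Fin d) × UnitAddTorus (Fin d)))
    [IsProbabilityMeasure γ] (hγ : γ.map Prod.fst = volume) {κ : Type*} [Fintype κ]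
    (f : κ → C(UnitAddTorus (Fin d) × UnitAddTorus (Fin d), ℝ)) {ε : ℝ} (hε : 0 < ε) :
    ∃ δ : ℝ, 0 < δ ∧ ∀ᶠ n : ℕ in atTop, ∃ y : (Fin d → Fin (n + 1)) → UnitAddTorus (Fin d),
      ∀ x : (Fin d → Fin (n + 1)) → UnitAddTorus (Fin d), (∀ i, x i ∈ Metric.ball (y i) δ) →
        ∀ k, |(Fintype.card (Fin d → Fin (n + 1)) : ℝ)⁻¹ *
          ∑ i, f k (gridTorus (n + 1) i, x i) - ∫ w, f k w ∂γ| < ε := by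
  -- Uniform continuity gives one radius for all `n`. Half of `ε` pays for sampling, half for moving
  -- first coordinates to lattice points and second ones inside balls.
  have huc : ∀ k, ∃ δ : ℝ, 0 < δ ∧ ∀ z w, dist z w < δ → dist (f k z) (f k w) < ε / 2 := fun k => by
    obtain ⟨δ, hδ, h⟩ := Metric.uniformContinuous_iff.1
      (CompactSpace.uniformContinuous_of_continuous (f k).continuous) (ε / 2) (half_pos hε)
    exact ⟨δ, hδ, fun z w hzw => h hzw⟩
  choose e he hek using huc
  obtain ⟨δ, hδ, hδe⟩ : ∃ δ : ℝ, 0 < δ ∧ ∀ k, δ ≤ e k := by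
    rcases isEmpty_or_nonempty κ with h | h
    · exact ⟨1, one_pos, fun k => h.elim k⟩
    · obtain ⟨k, hk⟩ := Finite.exists_min e
      exact ⟨e k, he k, hk⟩
  refine ⟨δ, hδ, ?_⟩
  obtain ⟨m, hm⟩ := exists_nat_gt (1 / δ)
  filter_upwards [eventually_ge_atTop m, eventually_exists_sample γ hγ f (half_pos hε)]
    with n hn ⟨z, hz, hzf⟩
  refine ⟨fun i => (z i).2, fun x hx k => ?_⟩
  set N : ℝ := (Fintype.card (Fin d → Fin (n + 1)) : ℝ) with hN
  have hNpos : 0 < N := Nat.cast_pos.2 Fintype.card_pos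
  have hn1 : 1 / ((n + 1 : ℕ) : ℝ) < δ := by
    have : (m : ℝ) < ((n + 1 : ℕ) : ℝ) := by exact_mod_cast Nat.lt_succ_of_le hn
    rw [div_lt_iff₀ (by positivity)]
    rw [div_lt_iff₀ hδ] at hm
    nlinarith
  have hd : ∀ i, |f k (gridTorus (n + 1) i, x i) - f k (z i)| ≤ ε / 2 := by
    intro i
    refine (hek k _ _ (lt_of_lt_of_le ?_ (hδe k))).le
    rw [Prod.dist_eq, max_lt_iff]
    refine ⟨(dist_pi_lt_iff hδ).2 fun l => ?_, hx i⟩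
    rw [dist_comm, dist_eq_norm]
    have := norm_sub_gridTorus_cell_le n.succ_pos (z i).1 l
    rw [hz i] at this
    exact this.trans_lt hn1
  have h1 : |N⁻¹ * ∑ i, f k (gridTorus (n + 1) i, x i) - N⁻¹ * ∑ i, f k (z i)| ≤ ε / 2 := by
    rw [← mul_sub, ← Finset.sum_sub_distrib, abs_mul, abs_of_pos (inv_pos.2 hNpos)]
    calc N⁻¹ * |∑ i, (f k (gridTorus (n + 1) i, x i) - f k (z i))| ≤ N⁻¹ * (N * (ε / 2)) := by
          refine mul_le_mul_of_nonneg_left ?_ (inv_pos.2 hNpos).le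
          refine (Finset.abs_sum_le_sum_abs _ _).trans
            ((Finset.sum_le_card_nsmul _ _ _ fun i _ => hd i).trans ?_)
          rw [Finset.card_univ, nsmul_eq_mul]
      _ = ε / 2 := inv_mul_cancel_left₀ hNpos.ne' _
  have h2 := hzf k
  calc _ ≤ |N⁻¹ * ∑ i, f k (gridTorus (n + 1) i, x i) - N⁻¹ * ∑ i, f k (z i)| +
        |N⁻¹ * ∑ i, f k (z i) - ∫ w, f k w ∂γ| := abs_sub_le _ _ _
    _ < ε := by linarith

theorem integral_empirical {X ι : Type*} [TopologicalSpace X] [MeasurableSpace X]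
    [OpensMeasurableSpace X] [Fintype ι] [Nonempty ι] (x : ι → X) (g : C(X, ℝ)) :
    ∫ w, g w ∂(empirical x : Measure X) = (Fintype.card ι : ℝ)⁻¹ * ∑ i, g (x i) := by
  have hd : ∀ i, ∫ w, g w ∂(Measure.dirac (x i)) = g (x i) := fun i =>
    integral_dirac' _ _ g.measurable.stronglyMeasurable
  change ∫ w, g w ∂((Fintype.card ι : ℝ≥0∞)⁻¹ • ∑ i, Measure.dirac (x i)) = _
  rw [integral_smul_measure, integral_finsetSum_measure]
  · simp [hd]
  · exact fun i _ => integrable_dirac' g.measurable.stronglyMeasurable (by simp)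

/-- The cost function as a continuous map. -/
def sqDistMap (d : ℕ) : C(UnitAddTorus (Fin d) × UnitAddTorus (Fin d), ℝ) :=
  ⟨fun z => sqDist z.1 z.2, continuous_sqDist⟩

/-- Lower bound for the unnormalized mass of a neighbourhood. -/
theorem exists_mass_lower_bound (μ₀ : Measure (UnitAddTorus (Fin d)))
    [IsProbabilityMeasure μ₀] [μ₀.IsOpenPosMeasure]
    {H : (n : ℕ) → ((Fin d → Fin (n + 1)) → UnitAddTorus (Fin d)) → ℝ}
    (hH : ∀ n, IsMatchingHamiltonian (n + 1) (H n))
    {O : Set (ProbabilityMeasure (UnitAddTorus (Fin d)))}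
    {ν : ProbabilityMeasure (UnitAddTorus (Fin d))} (hO : O ∈ 𝓝 ν) {a : ℝ}
    (ha : W2sq volume (ν : Measure (UnitAddTorus (Fin d))) < ENNReal.ofReal a) :
    ∃ c : ℝ, 0 < c ∧ ∀ᶠ n : ℕ in atTop,
      ENNReal.ofReal (c ^ Fintype.card (Fin d → Fin (n + 1)) *
        Real.exp (-(((n + 1 : ℕ) : ℝ) * Fintype.card (Fin d → Fin (n + 1))) * a)) ≤
      ∫⁻ x in empirical ⁻¹' O, ENNReal.ofReal (Real.exp (-((n + 1 : ℕ) : ℝ) * H n x))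
        ∂(Measure.pi fun _ : Fin d → Fin (n + 1) => μ₀) := by
  obtain ⟨γ, ⟨hγ0, hγ1, hγ2⟩, hcost⟩ : ∃ γ : Measure (UnitAddTorus (Fin d) × UnitAddTorus (Fin d)),
      (IsProbabilityMeasure γ ∧ γ.map Prod.fst = volume ∧
        γ.map Prod.snd = (ν : Measure (UnitAddTorus (Fin d)))) ∧
      ∫⁻ z, ENNReal.ofReal (sqDist z.1 z.2) ∂γ < ENNReal.ofReal a := by
    simpa only [W2sq, iInf_lt_iff, exists_prop, Set.mem_ofPred_eq] using ha
  have hint : Integrable (sqDistMap d) γ := Integrable.of_bound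
    (sqDistMap d).measurable.aestronglyMeasurable d (ae_of_all _ fun z => by
      have h : 0 ≤ sqDistMap d z := sqDist_nonneg _ _
      rw [Real.norm_eq_abs, abs_of_nonneg h]
      exact sqDist_le _ _)
  have hI : ∫ z, sqDistMap d z ∂γ < a := by
    have h := ofReal_integral_eq_lintegral_ofReal hint (ae_of_all _ fun z => sqDist_nonneg _ _)
    exact (ENNReal.ofReal_lt_ofReal_iff'.1 (h.trans_lt hcost)).1
  obtain ⟨F, ε, hε, hF⟩ := exists_finset_integral_nhds hO
  -- `none` controls the matching cost and `some g` the test integrals of the second marginal, so a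
  -- single sample serves both.
  let f : Option F → C(UnitAddTorus (Fin d) × UnitAddTorus (Fin d), ℝ) := fun k =>
    k.elim (sqDistMap d) fun g => g.1.comp ⟨Prod.snd, continuous_snd⟩
  obtain ⟨δ, hδ, hbox⟩ := exists_box γ hγ1 f (lt_min hε (sub_pos.2 hI))
  obtain ⟨c, hc, hball⟩ := exists_pos_le_measure_ball μ₀ hδ
  refine ⟨c, hc, hbox.mono fun n ⟨y, hy⟩ => ?_⟩
  set N : ℕ := Fintype.card (Fin d → Fin (n + 1)) with hN
  have hNpos : (0 : ℝ) < N := Nat.cast_pos.2 Fintype.card_pos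
  let B : Set ((Fin d → Fin (n + 1)) → UnitAddTorus (Fin d)) :=
    Set.pi Set.univ fun i => Metric.ball (y i) δ
  have hBO : B ⊆ empirical ⁻¹' O := by
    intro x hx
    refine hF _ fun g hg => ?_
    have h := (hy x (fun i => hx i (Set.mem_univ i)) (some ⟨g, hg⟩)).trans_le (min_le_left _ _)
    rw [integral_empirical, ← hγ2, integral_map measurable_snd.aemeasurable
      g.measurable.aestronglyMeasurable]
    exact h
  have hBH : ∀ x ∈ B, Real.exp (-(((n + 1 : ℕ) : ℝ) * N) * a) ≤
      Real.exp (-((n + 1 : ℕ) : ℝ) * H n x) := by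
    intro x hx
    refine le_trans (Real.exp_le_exp.2 ?_) ((hH n).exp_le x)
    have h := (abs_lt.1 ((hy x (fun i => hx i (Set.mem_univ i)) none).trans_le
      (min_le_right _ _))).2
    have h' : (N : ℝ)⁻¹ * matchingCost (n + 1) x < a := by
      have h'' : (N : ℝ)⁻¹ * matchingCost (n + 1) x - ∫ z, sqDistMap d z ∂γ <
        a - ∫ z, sqDistMap d z ∂γ := h
      linarith
    rw [inv_mul_lt_iff₀ hNpos] at h'
    have : (0 : ℝ) ≤ ((n + 1 : ℕ) : ℝ) := by positivity
    nlinarith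
  have hBm : MeasurableSet B := MeasurableSet.univ_pi fun i => Metric.isOpen_ball.measurableSet
  calc ENNReal.ofReal (c ^ N * Real.exp (-(((n + 1 : ℕ) : ℝ) * N) * a))
      = ENNReal.ofReal (Real.exp (-(((n + 1 : ℕ) : ℝ) * N) * a)) *
          ENNReal.ofReal c ^ N := by
        rw [mul_comm, ENNReal.ofReal_mul (Real.exp_pos _).le, ENNReal.ofReal_pow hc.le]
    _ ≤ ENNReal.ofReal (Real.exp (-(((n + 1 : ℕ) : ℝ) * N) * a)) *
          (Measure.pi fun _ : Fin d → Fin (n + 1) => μ₀) B := by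
        gcongr
        rw [Measure.pi_pi, hN, ← Finset.card_univ, ← Finset.prod_const]
        exact Finset.prod_le_prod' fun i _ => hball _
    _ = ∫⁻ x in B, ENNReal.ofReal (Real.exp (-(((n + 1 : ℕ) : ℝ) * N) * a))
          ∂(Measure.pi fun _ : Fin d → Fin (n + 1) => μ₀) := by
        rw [setLIntegral_const]
    _ ≤ ∫⁻ x in B, ENNReal.ofReal (Real.exp (-((n + 1 : ℕ) : ℝ) * H n x))
          ∂(Measure.pi fun _ : Fin d → Fin (n + 1) => μ₀) :=
        setLIntegral_mono' hBm fun x hx => ENNReal.ofReal_le_ofReal (hBH x hx)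
    _ ≤ _ := lintegral_mono_set hBO

end LowerBound

/-! ### Large deviation bounds from exponential estimates. -/

section Criterion

variable {𝓧 : Type*} {μ : ℕ → Set 𝓧 → ℝ≥0∞} {r : ℕ → ℝ} {I : 𝓧 → ℝ≥0∞}

theorem one_div_mul_log_exp {ρ : ℝ} (hρ : 0 < ρ) (a : ℝ) :
    ((1 / ρ : ℝ) : EReal) * ENNReal.log (ENNReal.ofReal (Real.exp (-(ρ * a)))) = ((-a : ℝ) : EReal) := by
  rw [ENNReal.log_ofReal_of_pos (Real.exp_pos _), Real.log_exp, ← EReal.coe_mul]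
  congr 1
  field_simp

theorem neg_iInf_le_liminf (hr : ∀ n, 0 < r n) {O : Set 𝓧}
    (h : ∀ ν ∈ O, ∀ a : ℝ, I ν < ENNReal.ofReal a →
      ∀ᶠ n in atTop, ENNReal.ofReal (Real.exp (-(r n * a))) ≤ μ n O) :
    -((⨅ x ∈ O, I x : ℝ≥0∞) : EReal) ≤
      liminf (fun n => ((1 / r n : ℝ) : EReal) * ENNReal.log (μ n O)) atTop := by
  refine le_of_forall_lt_imp_le_of_dense fun c hc => ?_
  obtain ⟨b, hcb, hb⟩ := EReal.lt_iff_exists_real_btwn.1 hc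
  refine hcb.le.trans ?_
  have hJ : (⨅ x ∈ O, I x) < ENNReal.ofReal (-b) := by
    rw [← EReal.coe_ennreal_lt_coe_ennreal_iff, EReal.coe_ennreal_ofReal]
    refine (EReal.lt_neg_comm.1 hb).trans_le ?_
    rw [← EReal.coe_neg]
    exact EReal.coe_le_coe_iff.2 (le_max_left _ _)
  obtain ⟨ν, hν, hIν⟩ : ∃ ν ∈ O, I ν < ENNReal.ofReal (-b) := by
    simpa only [iInf_lt_iff, exists_prop] using hJ
  refine le_liminf_of_le (by isBoundedDefault) ((h ν hν _ hIν).mono fun n hn => ?_)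
  have h1 := one_div_mul_log_exp (hr n) (-b)
  rw [neg_neg] at h1
  rw [← h1]
  exact mul_le_mul_of_nonneg_left (ENNReal.log_le_log hn)
    (EReal.coe_nonneg.2 (one_div_pos.2 (hr n)).le)

/-- Negative `a` and nonpositive `b` must be allowed: `ENNReal.ofReal b` is then `0`, which covers a
vanishing infimum. Arbitrarily large `a` covers an infinite one. -/
theorem limsup_le_neg_iInf (hr : ∀ n, 0 < r n) {C : Set 𝓧}
    (h : ∀ a b : ℝ, a < b → (∀ ν ∈ C, ENNReal.ofReal b ≤ I ν) →
      ∀ᶠ n in atTop, μ n C ≤ ENNReal.ofReal (Real.exp (-(r n * a)))) :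
    limsup (fun n => ((1 / r n : ℝ) : EReal) * ENNReal.log (μ n C)) atTop ≤
      -((⨅ x ∈ C, I x : ℝ≥0∞) : EReal) := by
  refine le_of_forall_gt_imp_ge_of_dense fun c hc => ?_
  obtain ⟨a, hca, ha⟩ := EReal.lt_iff_exists_real_btwn.1 (EReal.neg_lt_comm.1 hc)
  obtain ⟨b, hab, hb⟩ := EReal.lt_iff_exists_real_btwn.1 ha
  have hJ : ENNReal.ofReal b ≤ ⨅ x ∈ C, I x := by
    rw [← EReal.coe_ennreal_le_coe_ennreal_iff, EReal.coe_ennreal_ofReal,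
      EReal.coe_strictMono.monotone.map_max]
    exact max_le hb.le (EReal.coe_ennreal_nonneg _)
  refine le_trans ?_ (EReal.neg_lt_comm.1 hca).le
  refine limsup_le_of_le (by isBoundedDefault)
    ((h a b (EReal.coe_lt_coe_iff.1 hab) fun ν hν => hJ.trans (iInf₂_le ν hν)).mono fun n hn => ?_)
  rw [← EReal.coe_neg, ← one_div_mul_log_exp (hr n) a]
  exact mul_le_mul_of_nonneg_left (ENNReal.log_le_log hn)
    (EReal.coe_nonneg.2 (one_div_pos.2 (hr n)).le)

end Criterion

/-! ### Factors negligible at speed `n^{d+1}`. -/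

section Asymptotics

theorem eventually_pow_le_exp (K : ℝ) (hK : 0 ≤ K) {ε : ℝ} (hε : 0 < ε) :
    ∀ᶠ n : ℕ in atTop, ∀ N : ℕ, K ^ N ≤ Real.exp (((n + 1 : ℕ) : ℝ) * N * ε) := by
  have h : Tendsto (fun n : ℕ => Real.exp (((n + 1 : ℕ) : ℝ) * ε)) atTop atTop :=
    Real.tendsto_exp_atTop.comp (((tendsto_natCast_atTop_atTop (R := ℝ)).comp
      (tendsto_add_atTop_nat 1)).atTop_mul_const hε)
  filter_upwards [h.eventually_ge_atTop K] with n hn N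
  calc K ^ N ≤ Real.exp (((n + 1 : ℕ) : ℝ) * ε) ^ N := by gcongr
    _ = _ := by rw [← Real.exp_nat_mul]; ring_nf

/-- `N! ≤ N^N`, and the base `N = (n+1)^d` is eventually below `exp (ε (n+1))`. -/
theorem eventually_factorial_le_exp (d : ℕ) {ε : ℝ} (hε : 0 < ε) :
    ∀ᶠ n : ℕ in atTop, (((n + 1) ^ d).factorial : ℝ) ≤
      Real.exp (((n + 1 : ℕ) : ℝ) * ((n + 1) ^ d : ℕ) * ε) := by
  have h := ((isLittleO_pow_exp_pos_mul_atTop d hε).bound one_pos).natCast_atTop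
  filter_upwards [(tendsto_add_atTop_nat 1).eventually h] with n hn
  rw [one_mul, Real.norm_of_nonneg (by positivity), Real.norm_of_nonneg (by positivity)] at hn
  calc (((n + 1) ^ d).factorial : ℝ) ≤ (((n + 1) ^ d : ℕ) : ℝ) ^ ((n + 1) ^ d) := by
        exact_mod_cast Nat.factorial_le_pow _
    _ ≤ Real.exp (ε * ((n + 1 : ℕ) : ℝ)) ^ ((n + 1) ^ d) := by
        gcongr
        exact_mod_cast hn
    _ = _ := by rw [← Real.exp_nat_mul]; ring_nf

end Asymptotics

/-! ### The law of the empirical measure. -/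

section GibbsLaw

variable {X ι : Type*} [MeasurableSpace X] [Fintype ι]

theorem measurable_empirical [Nonempty ι] : Measurable (empirical : (ι → X) → _) := by
  refine Measurable.subtype_mk (Measure.measurable_of_measurable_coe _ fun s hs => ?_)
  simp only [Measure.smul_apply, Measure.finsetSum_apply, smul_eq_mul]
  refine Measurable.const_mul (Finset.measurable_sum _ fun i _ => ?_) _
  exact (Measure.measurable_coe hs).comp (Measure.measurable_dirac.comp (measurable_pi_apply i))

theorem empiricalGibbsLaw_apply [Nonempty ι] (μ₀ : Measure X) (β : ℝ) (H : (ι → X) → ℝ)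
    {S : Set (ProbabilityMeasure X)} (hS : MeasurableSet S) :
    empiricalGibbsLaw μ₀ β H S = (partitionFunction μ₀ β H)⁻¹ *
      ∫⁻ x in empirical ⁻¹' S, ENNReal.ofReal (Real.exp (-β * H x))
        ∂(Measure.pi fun _ : ι => μ₀) := by
  rw [empiricalGibbsLaw, Measure.map_apply measurable_empirical hS, Measure.smul_apply,
    withDensity_apply _ (measurable_empirical hS), smul_eq_mul]

theorem isProbabilityMeasure_empiricalGibbsLaw [Nonempty ι] (μ₀ : Measure X) (β : ℝ)
    (H : (ι → X) → ℝ) (h0 : partitionFunction μ₀ β H ≠ 0) (h1 : partitionFunction μ₀ β H ≠ ∞) :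
    IsProbabilityMeasure (empiricalGibbsLaw μ₀ β H) := by
  refine ⟨?_⟩
  rw [empiricalGibbsLaw_apply _ _ _ MeasurableSet.univ, Set.preimage_univ, Measure.restrict_univ]
  exact ENNReal.inv_mul_cancel h0 h1

end GibbsLaw

/-! ### Exponential estimates and the large deviation principle. -/

section Main

variable {d : ℕ}

theorem W2sq_self (μ : Measure (UnitAddTorus (Fin d))) [IsProbabilityMeasure μ] :
    W2sq μ μ = 0 := by
  have hg : Measurable fun t : UnitAddTorus (Fin d) => (t, t) := by fun_prop
  have h : ∀ p : UnitAddTorus (Fin d) × UnitAddTorus (Fin d) → UnitAddTorus (Fin d),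
      Measurable p → (∀ t, p (t, t) = t) → (μ.map fun t => (t, t)).map p = μ := by
    intro p hp hpt
    rw [Measure.map_map hp hg, show (p ∘ fun t => (t, t)) = id from funext hpt, Measure.map_id]
  have hcont := continuous_sqDist (d := d)
  refine le_antisymm ((iInf₂_le (μ.map fun t => (t, t))
    ⟨Measure.isProbabilityMeasure_map hg.aemeasurable, h _ measurable_fst fun _ => rfl,
      h _ measurable_snd fun _ => rfl⟩).trans (le_of_eq ?_)) zero_le
  rw [lintegral_map (by fun_prop) hg]
  simp [sqDist_self]

theorem card_grid (d n : ℕ) : Fintype.card (Fin d → Fin (n + 1)) = (n + 1) ^ d := by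
  simp

variable (μ₀ : Measure (UnitAddTorus (Fin d))) [IsProbabilityMeasure μ₀]
  {H : (n : ℕ) → ((Fin d → Fin (n + 1)) → UnitAddTorus (Fin d)) → ℝ}

theorem mass_le (hH : ∀ n, IsMatchingHamiltonian (n + 1) (H n)) (n : ℕ)
    {S : Set (ProbabilityMeasure (UnitAddTorus (Fin d)))} (hS : MeasurableSet S) {B : ℝ}
    (hB : ∀ x : (Fin d → Fin (n + 1)) → UnitAddTorus (Fin d), empirical x ∈ S →
      ∀ σ : Equiv.Perm (Fin d → Fin (n + 1)), B ≤ matchingCost (n + 1) (x ∘ σ)) :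
    ∫⁻ x in empirical ⁻¹' S, ENNReal.ofReal (Real.exp (-((n + 1 : ℕ) : ℝ) * H n x))
        ∂(Measure.pi fun _ : Fin d → Fin (n + 1) => μ₀) ≤
      ENNReal.ofReal (((n + 1) ^ d).factorial * thetaConst d ^ ((n + 1) ^ d) *
        Real.exp (-((n + 1 : ℕ) : ℝ) * B)) := by
  refine (setLIntegral_mono' (measurable_empirical hS) fun x hx =>
    ENNReal.ofReal_le_ofReal ((hH n).le_exp x B (hB x hx))).trans ?_
  rw [setLIntegral_const, card_grid]
  exact mul_le_of_le_one_right zero_le prob_le_one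

theorem partitionFunction_ne_top (hH : ∀ n, IsMatchingHamiltonian (n + 1) (H n)) (n : ℕ) :
    partitionFunction μ₀ ((n + 1 : ℕ) : ℝ) (H n) ≠ ∞ := by
  have h := mass_le μ₀ hH n MeasurableSet.univ (B := 0) fun x _ σ =>
    Finset.sum_nonneg fun i _ => sqDist_nonneg _ _
  rw [Set.preimage_univ, Measure.restrict_univ] at h
  exact (h.trans_lt ENNReal.ofReal_lt_top).ne

theorem partitionFunction_ne_zero (hH : ∀ n, IsMatchingHamiltonian (n + 1) (H n)) (n : ℕ) :
    partitionFunction μ₀ ((n + 1 : ℕ) : ℝ) (H n) ≠ 0 := by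
  have h : ∫⁻ _, ENNReal.ofReal (Real.exp (-((n + 1 : ℕ) : ℝ) *
      ∑ _i : Fin d → Fin (n + 1), (d : ℝ))) ∂(Measure.pi fun _ : Fin d → Fin (n + 1) => μ₀) ≤
      partitionFunction μ₀ ((n + 1 : ℕ) : ℝ) (H n) := by
    refine lintegral_mono fun x => ENNReal.ofReal_le_ofReal (le_trans (Real.exp_le_exp.2 ?_)
      ((hH n).exp_le x))
    have h1 : matchingCost (n + 1) x ≤ ∑ _i : Fin d → Fin (n + 1), (d : ℝ) :=
      Finset.sum_le_sum fun i _ => sqDist_le _ _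
    have h2 : (0 : ℝ) ≤ ((n + 1 : ℕ) : ℝ) := by positivity
    nlinarith
  rw [lintegral_const, measure_univ, mul_one] at h
  exact ((ENNReal.ofReal_pos.2 (Real.exp_pos _)).trans_le h).ne'

theorem eventually_mass_le_exp (hH : ∀ n, IsMatchingHamiltonian (n + 1) (H n))
    {S : Set (ProbabilityMeasure (UnitAddTorus (Fin d)))} (hS : MeasurableSet S) {a b : ℝ}
    (hab : a < b)
    (hb : ∀ ν ∈ S, ENNReal.ofReal b ≤ W2sq volume (ν : Measure (UnitAddTorus (Fin d)))) :
    ∀ᶠ n : ℕ in atTop,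
      ∫⁻ x in empirical ⁻¹' S, ENNReal.ofReal (Real.exp (-((n + 1 : ℕ) : ℝ) * H n x))
        ∂(Measure.pi fun _ : Fin d → Fin (n + 1) => μ₀) ≤
      ENNReal.ofReal (Real.exp (-(((n + 1 : ℕ) : ℝ) * ((n + 1) ^ d : ℕ) * a))) := by
  have hε : 0 < (b - a) / 2 := by linarith
  have hC := thetaConst_pos d
  filter_upwards [eventually_factorial_le_exp d hε,
    -- `Real.exp d` absorbs the discretization error: `d / (n+1)` per point, multiplied by the
    -- inverse temperature `n + 1`.
    eventually_pow_le_exp (thetaConst d * Real.exp d) (by positivity) hε] with n h1 h2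
  have hn : (0 : ℝ) < ((n + 1 : ℕ) : ℝ) := by positivity
  set N : ℝ := (((n + 1) ^ d : ℕ) : ℝ) with hN
  have hNpos : 0 < N := by positivity
  refine (mass_le μ₀ hH n hS (B := N * (b - d / ((n + 1 : ℕ) : ℝ))) fun x hx σ => ?_).trans
    (ENNReal.ofReal_le_ofReal ?_)
  · have h := (hb _ hx).trans (W2sq_empirical_le n.succ_pos x σ)
    have h0 : 0 ≤ matchingCost (n + 1) (x ∘ σ) := Finset.sum_nonneg fun i _ => sqDist_nonneg _ _
    rw [card_grid, ← hN, ENNReal.ofReal_le_ofReal_iff (by positivity)] at h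
    have h3 : b - d / ((n + 1 : ℕ) : ℝ) ≤ N⁻¹ * matchingCost (n + 1) (x ∘ σ) := by linarith
    rwa [le_inv_mul_iff₀ hNpos] at h3
  · have h3 : Real.exp (-((n + 1 : ℕ) : ℝ) * (N * (b - d / ((n + 1 : ℕ) : ℝ)))) =
        Real.exp d ^ ((n + 1) ^ d) * Real.exp (-(((n + 1 : ℕ) : ℝ) * N * b)) := by
      rw [← Real.exp_nat_mul, ← Real.exp_add, ← hN]
      congr 1
      field_simp
      ring
    calc _ = (((n + 1) ^ d).factorial : ℝ) * (thetaConst d * Real.exp d) ^ ((n + 1) ^ d) *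
          Real.exp (-(((n + 1 : ℕ) : ℝ) * N * b)) := by
          rw [h3, mul_pow]
          ring
      _ ≤ Real.exp (((n + 1 : ℕ) : ℝ) * N * ((b - a) / 2)) *
          Real.exp (((n + 1 : ℕ) : ℝ) * N * ((b - a) / 2)) *
          Real.exp (-(((n + 1 : ℕ) : ℝ) * N * b)) := by
          gcongr
          exact h2 _
      _ = _ := by
          rw [← Real.exp_add, ← Real.exp_add]
          ring_nf

variable [μ₀.IsOpenPosMeasure]

theorem eventually_exp_le_mass (hH : ∀ n, IsMatchingHamiltonian (n + 1) (H n))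
    {O : Set (ProbabilityMeasure (UnitAddTorus (Fin d)))}
    {ν : ProbabilityMeasure (UnitAddTorus (Fin d))} (hO : O ∈ 𝓝 ν) {a b : ℝ} (hab : a < b)
    (ha : W2sq volume (ν : Measure (UnitAddTorus (Fin d))) < ENNReal.ofReal a) :
    ∀ᶠ n : ℕ in atTop,
      ENNReal.ofReal (Real.exp (-(((n + 1 : ℕ) : ℝ) * ((n + 1) ^ d : ℕ) * b))) ≤
      ∫⁻ x in empirical ⁻¹' O, ENNReal.ofReal (Real.exp (-((n + 1 : ℕ) : ℝ) * H n x))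
        ∂(Measure.pi fun _ : Fin d → Fin (n + 1) => μ₀) := by
  obtain ⟨c, hc, h⟩ := exists_mass_lower_bound μ₀ hH hO ha
  filter_upwards [h, eventually_pow_le_exp c⁻¹ (inv_pos.2 hc).le (sub_pos.2 hab)] with n hn hcn
  refine le_trans (ENNReal.ofReal_le_ofReal ?_) hn
  rw [card_grid]
  have h1 := hcn ((n + 1) ^ d)
  have h2 : Real.exp (-(((n + 1 : ℕ) : ℝ) * ((n + 1) ^ d : ℕ) * (b - a))) ≤ c ^ ((n + 1) ^ d) := by
    rw [Real.exp_neg]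
    rw [inv_pow] at h1
    exact inv_le_of_inv_le₀ (by positivity) h1
  calc _ = Real.exp (-(((n + 1 : ℕ) : ℝ) * ((n + 1) ^ d : ℕ) * (b - a))) *
        Real.exp (-(((n + 1 : ℕ) : ℝ) * ((n + 1) ^ d : ℕ)) * a) := by
        rw [← Real.exp_add]
        ring_nf
    _ ≤ _ := by gcongr

/-- The whole space is a neighbourhood of `dx`, where the rate vanishes. -/
theorem eventually_exp_le_partitionFunction (hH : ∀ n, IsMatchingHamiltonian (n + 1) (H n))
    {ε : ℝ} (hε : 0 < ε) :
    ∀ᶠ n : ℕ in atTop,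
      ENNReal.ofReal (Real.exp (-(((n + 1 : ℕ) : ℝ) * ((n + 1) ^ d : ℕ) * ε))) ≤
        partitionFunction μ₀ ((n + 1 : ℕ) : ℝ) (H n) := by
  have h := eventually_exp_le_mass μ₀ hH (O := Set.univ)
    (ν := ⟨(volume : Measure (UnitAddTorus (Fin d))), inferInstance⟩) univ_mem (half_lt_self hε)
    (by
      rw [ProbabilityMeasure.coe_mk, W2sq_self]
      exact ENNReal.ofReal_pos.2 (half_pos hε))
  simpa only [Set.preimage_univ, Measure.restrict_univ, partitionFunction] using h

/-- The large deviation principle for all Hamiltonians that are comparable to the least matching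
cost. -/
theorem LDP_of_isMatchingHamiltonian (hH : ∀ n, IsMatchingHamiltonian (n + 1) (H n)) :
    LDP (fun n : ℕ => empiricalGibbsLaw μ₀ ((n + 1 : ℕ) : ℝ) (H n))
      (fun n : ℕ => ((n + 1 : ℕ) : ℝ) ^ (d + 1))
      (fun ν : ProbabilityMeasure (UnitAddTorus (Fin d)) =>
        W2sq volume (ν : Measure (UnitAddTorus (Fin d)))) := by
  have hr : ∀ n : ℕ, ((n + 1 : ℕ) : ℝ) ^ (d + 1) = ((n + 1 : ℕ) : ℝ) * ((n + 1) ^ d : ℕ) := by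
    intro n
    push_cast
    ring
  have hpos : ∀ n : ℕ, 0 < ((n + 1 : ℕ) : ℝ) ^ (d + 1) := fun n => by positivity
  have hZ0 := partitionFunction_ne_zero μ₀ hH
  have hZ1 := partitionFunction_ne_top μ₀ hH
  refine ⟨fun n => isProbabilityMeasure_empiricalGibbsLaw μ₀ _ _ (hZ0 n) (hZ1 n), hpos, ?_, ?_,
    lowerSemicontinuous_transportCost volume continuous_sqDist, fun O hO => ?_, fun C hC => ?_⟩
  · intro m n hmn
    dsimp only
    gcongr
  · exact (tendsto_pow_atTop d.succ_ne_zero).comp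
      ((tendsto_natCast_atTop_atTop (R := ℝ)).comp (tendsto_add_atTop_nat 1))
  · refine neg_iInf_le_liminf (μ := fun n S => empiricalGibbsLaw μ₀ _ (H n) S) hpos
      fun ν hν a ha => ?_
    obtain ⟨b, hb0, hνb, hba⟩ := ENNReal.lt_iff_exists_real_btwn.1 ha
    have hba' : b < a := (ENNReal.ofReal_lt_ofReal_iff'.1 hba).1
    have hε : 0 < (a - b) / 2 := by linarith
    -- The mass estimate on the whole space with `b = 0` bounds the partition function above. The
    -- gap `a - b` is split evenly: `(a + b)/2 + (a - b)/2 = a`.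
    have hZ := eventually_mass_le_exp μ₀ hH MeasurableSet.univ (neg_lt_zero.2 hε)
      (fun ν _ => by simp)
    filter_upwards [eventually_exp_le_mass μ₀ hH (hO.mem_nhds hν)
      (show b < (a + b) / 2 by linarith) hνb, hZ] with n h1 h2
    rw [Set.preimage_univ, Measure.restrict_univ] at h2
    rw [empiricalGibbsLaw_apply _ _ _ (measurableSet_of_isOpen hO), hr]
    calc _ = (ENNReal.ofReal (Real.exp (-(((n + 1 : ℕ) : ℝ) * ((n + 1) ^ d : ℕ) *
            -((a - b) / 2)))))⁻¹ * ENNReal.ofReal (Real.exp (-(((n + 1 : ℕ) : ℝ) *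
            ((n + 1) ^ d : ℕ) * ((a + b) / 2)))) := by
          rw [← ENNReal.ofReal_inv_of_pos (Real.exp_pos _), ← Real.exp_neg,
            ← ENNReal.ofReal_mul (Real.exp_pos _).le, ← Real.exp_add]
          ring_nf
      _ ≤ _ := mul_le_mul' (ENNReal.inv_le_inv.2 h2) h1
  · refine limsup_le_neg_iInf (μ := fun n S => empiricalGibbsLaw μ₀ _ (H n) S) hpos
      fun a b hab hb => ?_
    have hε : 0 < (b - a) / 2 := by linarith
    have hCm : MeasurableSet C := by
      simpa using (measurableSet_of_isOpen hC.isOpen_compl).compl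
    filter_upwards [eventually_mass_le_exp μ₀ hH hCm (show (a + b) / 2 < b by linarith) hb,
      eventually_exp_le_partitionFunction μ₀ hH hε] with n h1 h2
    rw [empiricalGibbsLaw_apply _ _ _ hCm, hr]
    calc _ ≤ (ENNReal.ofReal (Real.exp (-(((n + 1 : ℕ) : ℝ) * ((n + 1) ^ d : ℕ) *
            ((b - a) / 2)))))⁻¹ * ENNReal.ofReal (Real.exp (-(((n + 1 : ℕ) : ℝ) *
            ((n + 1) ^ d : ℕ) * ((a + b) / 2)))) := mul_le_mul' (ENNReal.inv_le_inv.2 h2) h1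
      _ = _ := by
          rw [← ENNReal.ofReal_inv_of_pos (Real.exp_pos _), ← Real.exp_neg,
            ← ENNReal.ofReal_mul (Real.exp_pos _).le, ← Real.exp_add]
          ring_nf

end Main

end TorusLDP

end

theorem lemma8p9 (d : ℕ) (μ₀ : Measure (UnitAddTorus (Fin d)))
    [IsProbabilityMeasure μ₀] [μ₀.IsOpenPosMeasure] :
    TorusLDP.LDP
        (fun n : ℕ => TorusLDP.empiricalGibbsLaw μ₀ ((n + 1 : ℕ) : ℝ)
          (TorusLDP.hamiltonian (d := d) (n + 1)))
        (fun n : ℕ => ((n + 1 : ℕ) : ℝ) ^ (d + 1))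
        (fun ν : ProbabilityMeasure (UnitAddTorus (Fin d)) =>
          TorusLDP.W2sq volume (ν : Measure (UnitAddTorus (Fin d)))) ∧
      TorusLDP.LDP
        (fun n : ℕ => TorusLDP.empiricalGibbsLaw μ₀ ((n + 1 : ℕ) : ℝ)
          (TorusLDP.tropicalHamiltonian (d := d) (n + 1)))
        (fun n : ℕ => ((n + 1 : ℕ) : ℝ) ^ (d + 1))
        (fun ν : ProbabilityMeasure (UnitAddTorus (Fin d)) =>
          TorusLDP.W2sq volume (ν : Measure (UnitAddTorus (Fin d)))) :=
  ⟨TorusLDP.LDP_of_isMatchingHamiltonian μ₀ fun n =>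
      TorusLDP.isMatchingHamiltonian_hamiltonian n.succ_pos,
    TorusLDP.LDP_of_isMatchingHamiltonian μ₀ fun n =>
      TorusLDP.isMatchingHamiltonian_tropicalHamiltonian n.succ_pos⟩
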